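/- Let $n,m,q\ge 0$ and $N_c\ge 1$ be integers, $U\subset\mathbb R^m$ bounded and convex, $x_0\in\mathbb R^n$, $\gamma>0$ and $L>0$. Let $f(\cdot,\cdot,\cdot,e_i):\mathbb R\times\mathbb R^n\times\mathbb R^m\to\mathbb R^n$ $(1\le i\le q)$, $h_0:\mathbb R^n\to\mathbb R$ and $h_j:\mathbb R^n\to\mathbb R$ $(1\le j\le N_c)$ be such that - on $[0,1]\times\mathbb R^n\times U$ each $f(\cdot,\cdot,\cdot,e_i)$ is differentiable in $x$ and in $u$, and $f(\cdot,\cdot,\cdot,e_i)$, $\frac{\partial f}{\partial x}(\cdot,\cdot,\cdot,e_i)$, $\frac{\partial f}{\partial u}(\cdot,\cdot,\cdot,e_i)$ are $L$-Lipschitz there with respect to $|t|+\|x\|_2+\|u\|_2$ (derivatives in the induced $2$-norm); - $h_0$ and all $h_j$ are differentiable, and they and their derivatives are $L$-Lipschitz. Let $\Sigma_r^q=\{d\in[0,1]^q:\sum_i d_i=1\}$ and $\Sigma_p^q=\{d\in\{0,1\}^q:\sum_i d_i=1\}$. Let $\mathcal U$, $\mathcal D_r$, $\mathcal D_p$ be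 the sets of square-integrable functions of bounded variation from $[0,1]$ to $U$, $\Sigma_r^q$, $\Sigma_p^q$ respectively, and put $\mathcal X_r=\mathcal U\times\mathcal D_r$, $\mathcal X_p=\mathcal U\times\mathcal D_p$, $\|(u,d)\|_{\mathcal X}=\|u\|_{L^2}+\|d\|_{L^2}$. For $\xi=(u,d)\in\mathcal X_r$ let $x^{(\xi)}:[0,1]\to\mathbb R^n$ be the (absolutely continuous) solution of $$\dot x(t)=\sum_{i=1}^q d_i(t)\,f\bigl(t,x(t),u(t),e_i\bigr)\ \text{ for a.e. } t\in[0,1],\qquad x(0)=x_0,$$ and put $$J(\xi)=h_0\bigl(x^{(\xi)}(1)\bigr),\qquad \psi_{j,t}(\xi)=h_j\bigl(x^{(\xi)}(t)\bigr),\qquad \Psi(\xi)=\max_{1\le j\le N_c,\ t\in[0,1]}\psi_{j,t}(\xi).$$ Write $\mathrm DG(\xi;\xi'')=\lim_{\lambda\downarrow0}\lambda^{-1}\bigl(G(\xi+\lambda\xi'')-G(\xi)\bigr)$. For $\xi\in\mathcal X_p$ and $\xi'\in\mathcal X_r$ let $$\zeta(\xi,\xi')=\begin{cases}\max\bigl\{\mathrm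 DJ(\xi;\xi'-\xi),\ \max_{j,t}\mathrm D\psi_{j,t}(\xi;\xi'-\xi)+\gamma\Psi(\xi)\bigr\}+\|\xi'-\xi\|_{\mathcal X}&\text{if }\Psi(\xi)\le0,\\ \max\bigl\{\mathrm DJ(\xi;\xi'-\xi)-\Psi(\xi),\ \max_{j,t}\mathrm D\psi_{j,t}(\xi;\xi'-\xi)\bigr\}+\|\xi'-\xi\|_{\mathcal X}&\text{if }\Psi(\xi)>0,\end{cases}$$ and let $\theta(\xi)=\inf_{\xi'\in\mathcal X_r}\zeta(\xi,\xi')$ (which is the minimum whenever it is attained). A point $\xi\in\mathcal X_p$ is a local minimizer of the switched system optimal control problem $\min\{J(\xi):\xi\in\mathcal X_p,\ \Psi(\xi)\le0\}$ if $\Psi(\xi)\le0$ and there is $\varepsilon>0$ such that $J(\hat\xi)\ge J(\xi)$ for every $\hat\xi\in\mathcal X_p$ with $\Psi(\hat\xi)\le0$ and $\|x^{(\xi)}-x^{(\hat\xi)}\|_{L^2}<\varepsilon$. Then these objects are well defined: every $\xi\in\mathcal X_r$ has exactly one trajectory $x^{(\xi)}$ and the maximum $\Psi(\xi)$ is attained;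 for $\xi\in\mathcal X_p$ and $\xi'\in\mathcal X_r$ the directional derivatives of $J$ and of all $\psi_{j,t}$ at $\xi$ in the direction $\xi'-\xi$ exist, and the maximum of the latter over $(j,t)$ is attained; and $\theta(\xi)$ is finite for each $\xi\in\mathcal X_p$. Moreover: 1. $\theta(\xi)\le0$ for every $\xi\in\mathcal X_p$; 2. if $\xi\in\mathcal X_p$ is a local minimizer of the switched system optimal control problem, then $\theta(\xi)=0$. -/

import Mathlib

open Set Filter Topology MeasureTheory

noncomputable section

/-- The data of a constrained switched-system optimal control problem on `[0,1]`: `q` vector fields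
`f · · · i` (the modes), the set `U` of values of the continuous input, the initial state `x₀`,
the terminal cost `h₀` and the constraint functions `h j`. -/
structure SwitchedSystem (n m q Nc : ℕ) where
  f : ℝ → EuclideanSpace ℝ (Fin n) → EuclideanSpace ℝ (Fin m) → Fin q → EuclideanSpace ℝ (Fin n)
  U : Set (EuclideanSpace ℝ (Fin m))
  x₀ : EuclideanSpace ℝ (Fin n)
  h₀ : EuclideanSpace ℝ (Fin n) → ℝ
  h : Fin Nc → EuclideanSpace ℝ (Fin n) → ℝ

/-- Pairs `ξ = (u, d)` of a continuous and a discrete input, with their vector space structure.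
Functions on `[0,1]` are written as functions on `ℝ` of which only the values on `[0,1]` are used. -/
abbrev SwitchedInput (m q : ℕ) : Type :=
  (ℝ → EuclideanSpace ℝ (Fin m)) × (ℝ → EuclideanSpace ℝ (Fin q))

/-- The simplex `Σ_r^q`. -/
def relaxedSimplex (q : ℕ) : Set (EuclideanSpace ℝ (Fin q)) :=
  {d | (∀ i, d i ∈ Icc (0 : ℝ) 1) ∧ ∑ i, d i = 1}

/-- The corners `Σ_p^q` of the simplex. -/
def pureSimplex (q : ℕ) : Set (EuclideanSpace ℝ (Fin q)) :=
  {d | (∀ i, d i = 0 ∨ d i = 1) ∧ ∑ i, d i = 1}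

/-- `L²([0,1], Y) ∩ BV([0,1], Y)`. (All norms of `ℝᵏ` give the same functions of bounded
variation.) -/
def bvInputs {k : ℕ} (Y : Set (EuclideanSpace ℝ (Fin k))) : Set (ℝ → EuclideanSpace ℝ (Fin k)) :=
  {v | (∀ t ∈ Icc (0 : ℝ) 1, v t ∈ Y) ∧ MemLp v 2 (volume.restrict (Icc (0 : ℝ) 1)) ∧
    BoundedVariationOn v (Icc (0 : ℝ) 1)}

/-- The norm of `L²([0,1], ℝᵏ)`. -/
def normL2 {k : ℕ} (v : ℝ → EuclideanSpace ℝ (Fin k)) : ℝ :=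
  Real.sqrt (∫ t in (0 : ℝ)..1, ‖v t‖ ^ 2)

/-- `‖ξ‖_𝒳 = ‖u‖_{L²} + ‖d‖_{L²}`. -/
def normX {m q : ℕ} (ξ : SwitchedInput m q) : ℝ := normL2 ξ.1 + normL2 ξ.2

/-- The difference quotient `(G(ξ + s ξ') - G(ξ)) / s`. -/
def diffQuotient {m q : ℕ} (G : SwitchedInput m q → ℝ) (ξ ξ' : SwitchedInput m q) (s : ℝ) : ℝ :=
  (G (ξ + s • ξ') - G ξ) / s

/-- The directional derivative `DG(ξ; ξ')`, the limit of the difference quotients as `s ↓ 0`. -/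
def dirDeriv {m q : ℕ} (G : SwitchedInput m q → ℝ) (ξ ξ' : SwitchedInput m q) : ℝ :=
  limUnder (𝓝[>] (0 : ℝ)) (diffQuotient G ξ ξ')

namespace SwitchedSystem

variable {n m q Nc : ℕ}

/-- The relaxed optimization space `𝒳_r`. -/
def Xr (S : SwitchedSystem n m q Nc) : Set (SwitchedInput m q) :=
  bvInputs S.U ×ˢ bvInputs (relaxedSimplex q)

/-- The pure optimization space `𝒳_p`. -/
def Xp (S : SwitchedSystem n m q Nc) : Set (SwitchedInput m q) :=
  bvInputs S.U ×ˢ bvInputs (pureSimplex q)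

/-- `f(t, x, u, d) = ∑ i, d_i f(t, x, u, e_i)`. -/
def field (S : SwitchedSystem n m q Nc) (t : ℝ) (x : EuclideanSpace ℝ (Fin n))
    (u : EuclideanSpace ℝ (Fin m)) (d : EuclideanSpace ℝ (Fin q)) : EuclideanSpace ℝ (Fin n) :=
  ∑ i, d i • S.f t x u i

/-- `x` solves `ẋ(t) = f(t, x(t), u(t), d(t))` on `[0,1]`, `x(0) = x₀`. As the inputs may jump, the
equation is meant in integrated form (`x` is absolutely continuous and satisfies it a.e.). -/
def IsTrajectory (S : SwitchedSystem n m q Nc) (ξ : SwitchedInput m q)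
    (x : ℝ → EuclideanSpace ℝ (Fin n)) : Prop :=
  IntervalIntegrable (fun s => S.field s (x s) (ξ.1 s) (ξ.2 s)) volume 0 1 ∧
  ∀ t ∈ Icc (0 : ℝ) 1, x t = S.x₀ + ∫ s in (0 : ℝ)..t, S.field s (x s) (ξ.1 s) (ξ.2 s)

/-- The trajectory `x^{(ξ)}`. -/
def traj (S : SwitchedSystem n m q Nc) (ξ : SwitchedInput m q) : ℝ → EuclideanSpace ℝ (Fin n) :=
  Classical.epsilon (S.IsTrajectory ξ)

/-- The cost `J(ξ) = h₀(x^{(ξ)}(1))`. -/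
def J (S : SwitchedSystem n m q Nc) (ξ : SwitchedInput m q) : ℝ := S.h₀ (S.traj ξ 1)

/-- The component constraints `ψ_{j,t}(ξ) = h_j(x^{(ξ)}(t))`. -/
def psi (S : SwitchedSystem n m q Nc) (p : Fin Nc × Icc (0 : ℝ) 1) (ξ : SwitchedInput m q) : ℝ :=
  S.h p.1 (S.traj ξ p.2)

/-- The constraint function `Ψ(ξ) = max_{j, t} ψ_{j,t}(ξ)`. -/
def Psi (S : SwitchedSystem n m q Nc) (ξ : SwitchedInput m q) : ℝ := ⨆ p, S.psi p ξ

/-- `max_{j, t} Dψ_{j,t}(ξ; ξ')`. -/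
def maxDpsi (S : SwitchedSystem n m q Nc) (ξ ξ' : SwitchedInput m q) : ℝ :=
  ⨆ p, dirDeriv (S.psi p) ξ ξ'

/-- The `ε`-ball around `ξ` in the weak topology of `𝒳_r` induced by trajectories. -/
def weakBall (S : SwitchedSystem n m q Nc) (ξ : SwitchedInput m q) (ε : ℝ) :
    Set (SwitchedInput m q) :=
  {ξ' | ξ' ∈ S.Xr ∧ normL2 (S.traj ξ - S.traj ξ') < ε}

/-- Local minimizers of `min {J(ξ) | ξ ∈ 𝒳_p, Ψ(ξ) ≤ 0}` in the weak topology. -/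
def IsLocalMinimizer (S : SwitchedSystem n m q Nc) (ξ : SwitchedInput m q) : Prop :=
  ξ ∈ S.Xp ∧ S.Psi ξ ≤ 0 ∧
    ∃ ε > 0, ∀ ξ' ∈ S.weakBall ξ ε ∩ {ξ' | ξ' ∈ S.Xp ∧ S.Psi ξ' ≤ 0}, S.J ξ' ≥ S.J ξ

/-- The function `ζ(ξ, ξ')` with design parameter `γ`. -/
def zeta (S : SwitchedSystem n m q Nc) (γ : ℝ) (ξ ξ' : SwitchedInput m q) : ℝ :=
  if S.Psi ξ ≤ 0 then
    max (dirDeriv S.J ξ (ξ' - ξ)) (S.maxDpsi ξ (ξ' - ξ) + γ * S.Psi ξ) + normX (ξ' - ξ)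
  else
    max (dirDeriv S.J ξ (ξ' - ξ) - S.Psi ξ) (S.maxDpsi ξ (ξ' - ξ)) + normX (ξ' - ξ)

/-- The optimality function: the minimal value of `ζ(ξ, ·)` on `𝒳_r`, as an infimum since `U` need
not be closed. -/
def theta (S : SwitchedSystem n m q Nc) (γ : ℝ) (ξ : SwitchedInput m q) : ℝ :=
  sInf (S.zeta γ ξ '' S.Xr)

/-- Each mode is differentiable in `x` and in `u`, and it and its two partial derivatives are
Lipschitz with constant `L` on `[0,1] × ℝⁿ × U`. -/
structure RegularDynamics (S : SwitchedSystem n m q Nc) (L : ℝ) : Prop where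
  diff_x : ∀ i, ∀ t ∈ Icc (0 : ℝ) 1, ∀ x, ∀ u ∈ S.U,
    DifferentiableAt ℝ (fun y => S.f t y u i) x
  diff_u : ∀ i, ∀ t ∈ Icc (0 : ℝ) 1, ∀ x, ∀ u ∈ S.U,
    DifferentiableAt ℝ (fun v => S.f t x v i) u
  lip_f : ∀ i, ∀ t₁ ∈ Icc (0 : ℝ) 1, ∀ t₂ ∈ Icc (0 : ℝ) 1, ∀ x₁ x₂, ∀ u₁ ∈ S.U, ∀ u₂ ∈ S.U,
    ‖S.f t₁ x₁ u₁ i - S.f t₂ x₂ u₂ i‖ ≤ L * (|t₁ - t₂| + ‖x₁ - x₂‖ + ‖u₁ - u₂‖)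
  lip_dx : ∀ i, ∀ t₁ ∈ Icc (0 : ℝ) 1, ∀ t₂ ∈ Icc (0 : ℝ) 1, ∀ x₁ x₂, ∀ u₁ ∈ S.U, ∀ u₂ ∈ S.U,
    ‖fderiv ℝ (fun y => S.f t₁ y u₁ i) x₁ - fderiv ℝ (fun y => S.f t₂ y u₂ i) x₂‖
      ≤ L * (|t₁ - t₂| + ‖x₁ - x₂‖ + ‖u₁ - u₂‖)
  lip_du : ∀ i, ∀ t₁ ∈ Icc (0 : ℝ) 1, ∀ t₂ ∈ Icc (0 : ℝ) 1, ∀ x₁ x₂, ∀ u₁ ∈ S.U, ∀ u₂ ∈ S.U,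
    ‖fderiv ℝ (fun v => S.f t₁ x₁ v i) u₁ - fderiv ℝ (fun v => S.f t₂ x₂ v i) u₂‖
      ≤ L * (|t₁ - t₂| + ‖x₁ - x₂‖ + ‖u₁ - u₂‖)

/-- The cost and constraint functions are differentiable, and they and their derivatives are
Lipschitz with constant `L`. -/
structure RegularCost (S : SwitchedSystem n m q Nc) (L : ℝ) : Prop where
  diff_h₀ : Differentiable ℝ S.h₀
  diff_h : ∀ j, Differentiable ℝ (S.h j)
  lip_h₀ : ∀ x₁ x₂, |S.h₀ x₁ - S.h₀ x₂| ≤ L * ‖x₁ - x₂‖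
  lip_dh₀ : ∀ x₁ x₂, ‖fderiv ℝ S.h₀ x₁ - fderiv ℝ S.h₀ x₂‖ ≤ L * ‖x₁ - x₂‖
  lip_h : ∀ j x₁ x₂, |S.h j x₁ - S.h j x₂| ≤ L * ‖x₁ - x₂‖
  lip_dh : ∀ j x₁ x₂, ‖fderiv ℝ (S.h j) x₁ - fderiv ℝ (S.h j) x₂‖ ≤ L * ‖x₁ - x₂‖

end SwitchedSystem

end

/-! Suppose a local minimizer `ξ` had `θ(ξ) < 0`. Some relaxed `ξ'` then has `ζ(ξ, ξ') < 0`, and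
since the norm term is nonnegative, both entries of the maximum are at most some `-c < 0`. Moving
from `ξ` to `ξ + l(ξ' - ξ)` changes `J` by at most `-cl + O(l²)` and leaves every constraint below
`(1 - γl)Ψ(ξ) - cl + O(l²)`, uniformly in `(j, t)`. For small `l` the cost drops strictly and the
constraints hold with a margin proportional to `l`. The moved input is only relaxed, but some pure
input has a trajectory uniformly as close to it as desired, so it inherits the decrease, the
feasibility and the closeness to `x^{(ξ)}`. Neighbourhoods are measured through trajectories, so the
pure input itself need not be near `ξ` in `L²`.

Two facts carry this. The first-order expansion (`exists_traj_expansion`,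
`exists_dirDeriv_expansion`) compares the perturbed trajectory with the solution of the variational
equation; the Taylor remainder of the field is quadratic in `l`, and Grönwall's inequality passes
this on to the state. The chattering lemma (`exists_pure_traj_near`) rounds the discrete input to a
pure one whose primitive stays close. Integrable functions are nearly orthogonal to differences with
small primitive, and Grönwall's inequality again turns this into closeness of trajectories.

For the remaining claims, `ζ(ξ, ξ) = 0` gives `θ ≤ 0`, and a bound on `DJ(ξ; ξ' - ξ)` uniform in
`ξ'` gives finiteness. -/

/-! ### Grönwall's inequality and Carathéodory solutions -/

/-- With the weight `exp (2Ks)`, integrating against a Lipschitz constant `K` gains a factor `1/2`.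
This drives both Grönwall's inequality and the contraction for existence. -/
theorem integral_mul_exp_two_mul (C K t : ℝ) :
    ∫ s in (0 : ℝ)..t, K * (C * Real.exp (2 * K * s)) = C / 2 * (Real.exp (2 * K * t) - 1) := by
  have hd : ∀ s ∈ uIcc (0 : ℝ) t, HasDerivAt (fun s => C / 2 * Real.exp (2 * K * s))
      (K * (C * Real.exp (2 * K * s))) s := by
    intro s _
    have h1 : HasDerivAt (fun s : ℝ => 2 * K * s) (2 * K) s := by
      simpa using (hasDerivAt_id s).const_mul (2 * K)
    exact (h1.exp.const_mul (C / 2)).congr_deriv (by ring)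
  rw [intervalIntegral.integral_eq_sub_of_hasDerivAt hd
    (Continuous.intervalIntegrable (by fun_prop) _ _)]
  simp
  ring

/-- Grönwall's inequality in integral form on `[0,1]`, with a non-optimal constant. -/
theorem le_of_le_add_integral {w : ℝ → ℝ} (hw : ContinuousOn w (Icc 0 1)) {a K : ℝ} (ha : 0 ≤ a)
    (hK : 0 ≤ K) (h : ∀ t ∈ Icc (0 : ℝ) 1, w t ≤ a + ∫ s in (0 : ℝ)..t, K * w s) :
    ∀ t ∈ Icc (0 : ℝ) 1, w t ≤ 2 * Real.exp (2 * K) * a := by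
  have hφ : ContinuousOn (fun t => w t * Real.exp (-(2 * K * t))) (Icc 0 1) :=
    hw.mul (by fun_prop)
  obtain ⟨t₀, ht₀, hmax⟩ := isCompact_Icc.exists_isMaxOn (nonempty_Icc.2 zero_le_one) hφ
  set M := w t₀ * Real.exp (-(2 * K * t₀)) with hM
  have hle : ∀ s ∈ Icc (0 : ℝ) 1, w s ≤ M * Real.exp (2 * K * s) := by
    intro s hs
    have h1 : w s * Real.exp (-(2 * K * s)) ≤ M := hmax hs
    calc w s = w s * Real.exp (-(2 * K * s)) * Real.exp (2 * K * s) := by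
          rw [mul_assoc, ← Real.exp_add]; simp
      _ ≤ _ := by gcongr
  -- At the maximizer of the weighted function the hypothesis reads `M ≤ a + M/2`, up to a term
  -- whose sign needs `0 ≤ M`; hence the separate case `M < 0`.
  have hM2 : M ≤ 2 * a := by
    rcases lt_or_ge M 0 with hneg | hpos
    · linarith
    have hint : ∫ s in (0 : ℝ)..t₀, K * w s ≤ M / 2 * (Real.exp (2 * K * t₀) - 1) := by
      rw [← integral_mul_exp_two_mul]
      refine intervalIntegral.integral_mono_on ht₀.1 ?_
        (Continuous.intervalIntegrable (by fun_prop) _ _) ?_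
      · refine ContinuousOn.intervalIntegrable ?_
        rw [uIcc_of_le ht₀.1]
        exact continuousOn_const.mul (hw.mono (Icc_subset_Icc_right ht₀.2))
      · intro s hs
        exact mul_le_mul_of_nonneg_left (hle s ⟨hs.1, hs.2.trans ht₀.2⟩) hK
    have h1 := h t₀ ht₀
    have he : Real.exp (2 * K * t₀) * Real.exp (-(2 * K * t₀)) = 1 := by
      rw [← Real.exp_add]; simp
    have he1 : Real.exp (-(2 * K * t₀)) ≤ 1 := by
      rw [Real.exp_le_one_iff]
      have := mul_nonneg hK ht₀.1
      linarith
    have hep := Real.exp_pos (-(2 * K * t₀))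
    have h2 : M ≤ (a + M / 2 * (Real.exp (2 * K * t₀) - 1)) * Real.exp (-(2 * K * t₀)) := by
      rw [hM]
      exact mul_le_mul_of_nonneg_right (by linarith) hep.le
    have h3 : (a + M / 2 * (Real.exp (2 * K * t₀) - 1)) * Real.exp (-(2 * K * t₀))
        = a * Real.exp (-(2 * K * t₀)) + M / 2 - M / 2 * Real.exp (-(2 * K * t₀)) := by
      linear_combination (M / 2) * he
    have h4 : a * Real.exp (-(2 * K * t₀)) ≤ a := mul_le_of_le_one_right ha he1
    have h5 : 0 ≤ M / 2 * Real.exp (-(2 * K * t₀)) := by positivity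
    linarith
  intro t ht
  calc w t ≤ M * Real.exp (2 * K * t) := hle t ht
    _ ≤ 2 * a * Real.exp (2 * K * t) := by gcongr
    _ ≤ 2 * a * Real.exp (2 * K) := by
        have := mul_le_mul_of_nonneg_left ht.2 hK
        exact mul_le_mul_of_nonneg_left (Real.exp_le_exp.2 (by linarith)) (by linarith)
    _ = _ := by ring

/-- Grönwall's inequality for a vector-valued function that is given as an integral, up to a small
error. -/
theorem norm_le_of_norm_sub_integral_le {E : Type*} [NormedAddCommGroup E] [NormedSpace ℝ E]
    {w g : ℝ → E} (hw : ContinuousOn w (Icc 0 1)) {a K : ℝ} (ha : 0 ≤ a) (hK : 0 ≤ K)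
    (h : ∀ t ∈ Icc (0 : ℝ) 1, ‖w t - ∫ s in (0 : ℝ)..t, g s‖ ≤ a)
    (hg : ∀ s ∈ Icc (0 : ℝ) 1, ‖g s‖ ≤ K * ‖w s‖) :
    ∀ t ∈ Icc (0 : ℝ) 1, ‖w t‖ ≤ 2 * Real.exp (2 * K) * a := by
  refine le_of_le_add_integral hw.norm ha hK fun t ht => ?_
  have h1 : ‖∫ s in (0 : ℝ)..t, g s‖ ≤ ∫ s in (0 : ℝ)..t, K * ‖w s‖ := by
    refine intervalIntegral.norm_integral_le_of_norm_le ht.1 ?_ ?_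
    · exact Eventually.of_forall fun s hs => hg s ⟨hs.1.le, hs.2.trans ht.2⟩
    · refine ContinuousOn.intervalIntegrable ?_
      rw [uIcc_of_le ht.1]
      exact continuousOn_const.mul (hw.norm.mono (Icc_subset_Icc_right ht.2))
  have h2 := h t ht
  have h3 := norm_le_norm_sub_add (w t) (∫ s in (0 : ℝ)..t, g s)
  linarith

/-- Existence of Carathéodory solutions on `[0,1]` for a right-hand side that is Lipschitz in the
state. -/
theorem exists_solution_of_lipschitz {E : Type*} [NormedAddCommGroup E] [NormedSpace ℝ E]
    [CompleteSpace E] {F : ℝ → E → E} {K : ℝ} (hK : 0 ≤ K) (x₀ : E)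
    (hint : ∀ x : ℝ → E, Continuous x → IntervalIntegrable (fun s => F s (x s)) volume 0 1)
    (hlip : ∀ s ∈ Icc (0 : ℝ) 1, ∀ x y, ‖F s x - F s y‖ ≤ K * ‖x - y‖) :
    ∃ x : ℝ → E, Continuous x ∧
      ∀ t ∈ Icc (0 : ℝ) 1, x t = x₀ + ∫ s in (0 : ℝ)..t, F s (x s) := by
  -- The unknown is written `x(s) = exp(2Ks) y(s)`, so the sup norm of `y` is a weighted norm of
  -- `x`. In it the Picard map contracts by `1/2` on all of `[0,1]`, and no gluing of short
  -- intervals is needed.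
  let ext : C(Icc (0 : ℝ) 1, E) → ℝ → E := fun y s =>
    Real.exp (2 * K * s) • IccExtend (zero_le_one (α := ℝ)) y s
  have hext : ∀ y, Continuous (ext y) := fun y =>
    Continuous.smul (by fun_prop) (y.continuous.Icc_extend')
  have hsub : ∀ t ∈ Icc (0 : ℝ) 1, uIcc (0 : ℝ) t ⊆ uIcc 0 1 := by
    intro t ht
    rw [uIcc_of_le ht.1, uIcc_of_le zero_le_one]
    exact Icc_subset_Icc_right ht.2
  have hcont : ∀ y, ContinuousOn (fun t => ∫ s in (0 : ℝ)..t, F s (ext y s)) (Icc 0 1) := by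
    intro y
    have := intervalIntegral.continuousOn_primitive_interval' (hint _ (hext y))
      (left_mem_uIcc (a := (0 : ℝ)) (b := 1))
    rwa [uIcc_of_le zero_le_one] at this
  let T : C(Icc (0 : ℝ) 1, E) → C(Icc (0 : ℝ) 1, E) := fun y =>
    ⟨fun t => Real.exp (-(2 * K * t)) • (x₀ + ∫ s in (0 : ℝ)..t, F s (ext y s)),
      Continuous.smul (by fun_prop) (continuous_const.add (hcont y).domRestrict)⟩
  have hTa : ∀ y t, T y t
      = Real.exp (-(2 * K * t)) • (x₀ + ∫ s in (0 : ℝ)..t, F s (ext y s)) := fun _ _ => rfl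
  have hT : ContractingWith (1 / 2) T := by
    refine ⟨by norm_num, LipschitzWith.of_dist_le_mul fun y z => ?_⟩
    rw [ContinuousMap.dist_le (by positivity)]
    intro t
    have hd : dist (T y t) (T z t) = Real.exp (-(2 * K * t)) *
        ‖∫ s in (0 : ℝ)..t, (F s (ext y s) - F s (ext z s))‖ := by
      rw [intervalIntegral.integral_sub ((hint _ (hext y)).mono_set (hsub t t.2))
        ((hint _ (hext z)).mono_set (hsub t t.2)), dist_eq_norm, hTa, hTa,
        ← smul_sub, norm_smul, add_sub_add_left_eq_sub, Real.norm_of_nonneg (Real.exp_pos _).le]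
    have hb : ‖∫ s in (0 : ℝ)..t, (F s (ext y s) - F s (ext z s))‖
        ≤ dist y z / 2 * (Real.exp (2 * K * t) - 1) := by
      rw [← integral_mul_exp_two_mul]
      refine intervalIntegral.norm_integral_le_of_norm_le t.2.1 ?_
        (Continuous.intervalIntegrable (by fun_prop) _ _)
      refine Eventually.of_forall fun s hs => (hlip s ⟨hs.1.le, hs.2.trans t.2.2⟩ _ _).trans ?_
      refine mul_le_mul_of_nonneg_left ?_ hK
      simp only [ext, ← smul_sub, norm_smul, Real.norm_of_nonneg (Real.exp_pos _).le]
      rw [mul_comm, ← dist_eq_norm]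
      exact mul_le_mul_of_nonneg_right (ContinuousMap.dist_apply_le_dist _) (Real.exp_pos _).le
    have he : Real.exp (-(2 * K * t)) * Real.exp (2 * K * t) = 1 := by
      rw [← Real.exp_add]; simp
    have hep := Real.exp_pos (-(2 * K * t))
    calc dist (T y t) (T z t)
        ≤ Real.exp (-(2 * K * t)) * (dist y z / 2 * (Real.exp (2 * K * t) - 1)) := by
          rw [hd]; gcongr
      _ = dist y z / 2 - dist y z / 2 * Real.exp (-(2 * K * t)) := by
          linear_combination (dist y z / 2) * he
      _ ≤ dist y z / 2 := by
          have : 0 ≤ dist y z / 2 * Real.exp (-(2 * K * t)) := by positivity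
          linarith
      _ = _ := by push_cast; ring
  have hfix := hT.fixedPoint_isFixedPt
  set y := hT.fixedPoint with hy
  refine ⟨ext y, hext y, fun t ht => ?_⟩
  have h1 : T y ⟨t, ht⟩ = y ⟨t, ht⟩ := by rw [hfix]
  have h2 : ext y t = Real.exp (2 * K * t) • y ⟨t, ht⟩ := by
    simp only [ext, IccExtend_of_mem _ _ ht]
  rw [h2, ← h1, hTa, smul_smul, ← Real.exp_add]
  simp

theorem intervalIntegrable_zero_one_of_bound {E : Type*} [NormedAddCommGroup E] {g : ℝ → E} {M : ℝ}
    (hg : AEStronglyMeasurable g (volume.restrict (Icc (0 : ℝ) 1)))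
    (hM : ∀ s ∈ Icc (0 : ℝ) 1, ‖g s‖ ≤ M) : IntervalIntegrable g volume 0 1 := by
  rw [intervalIntegrable_iff_integrableOn_Icc_of_le zero_le_one]
  exact Integrable.of_bound hg M
    ((ae_restrict_iff' measurableSet_Icc).2 (Eventually.of_forall hM))

theorem IntervalIntegrable.mono_zero_one {E : Type*} [NormedAddCommGroup E] {g : ℝ → E}
    (hg : IntervalIntegrable g volume 0 1) {a b : ℝ} (ha : a ∈ Icc (0 : ℝ) 1)
    (hb : b ∈ Icc (0 : ℝ) 1) : IntervalIntegrable g volume a b := by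
  refine hg.mono_set ?_
  rw [uIcc_of_le (zero_le_one (α := ℝ))]
  exact uIcc_subset_Icc ha hb

theorem norm_integral_le_of_bound {E : Type*} [NormedAddCommGroup E] [NormedSpace ℝ E] {g : ℝ → E}
    {M : ℝ} (hM : ∀ s ∈ Icc (0 : ℝ) 1, ‖g s‖ ≤ M) (t : ℝ) (ht : t ∈ Icc (0 : ℝ) 1) :
    ‖∫ s in (0 : ℝ)..t, g s‖ ≤ M := by
  have hM0 : 0 ≤ M := (norm_nonneg _).trans (hM 0 ⟨le_rfl, zero_le_one⟩)
  have h := intervalIntegral.norm_integral_le_of_norm_le_const (a := 0) (b := t) (f := g) (C := M)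
    (fun s hs => by
      rw [uIoc_of_le ht.1] at hs
      exact hM s ⟨hs.1.le, hs.2.trans ht.2⟩)
  rw [sub_zero, abs_of_nonneg ht.1] at h
  exact h.trans (mul_le_of_le_one_right hM0 ht.2)

theorem continuousOn_of_eq_add_integral {E : Type*} [NormedAddCommGroup E] [NormedSpace ℝ E]
    {x g : ℝ → E} {x₀ : E} (hg : IntervalIntegrable g volume 0 1)
    (hx : ∀ t ∈ Icc (0 : ℝ) 1, x t = x₀ + ∫ s in (0 : ℝ)..t, g s) :
    ContinuousOn x (Icc 0 1) := by
  have := intervalIntegral.continuousOn_primitive_interval' hg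
    (left_mem_uIcc (a := (0 : ℝ)) (b := 1))
  rw [uIcc_of_le zero_le_one] at this
  exact (continuousOn_const.add this).congr hx

/-- Two solutions are close if the second one nearly solves the first equation. -/
theorem norm_solution_sub_le {E : Type*} [NormedAddCommGroup E] [NormedSpace ℝ E]
    {F G : ℝ → E → E} {K a : ℝ} (hK : 0 ≤ K) (ha : 0 ≤ a) {x₀ : E} {x y : ℝ → E}
    (hlip : ∀ s ∈ Icc (0 : ℝ) 1, ∀ x y, ‖F s x - F s y‖ ≤ K * ‖x - y‖)
    (hFx : IntervalIntegrable (fun s => F s (x s)) volume 0 1)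
    (hFy : IntervalIntegrable (fun s => F s (y s)) volume 0 1)
    (hGy : IntervalIntegrable (fun s => G s (y s)) volume 0 1)
    (hx : ∀ t ∈ Icc (0 : ℝ) 1, x t = x₀ + ∫ s in (0 : ℝ)..t, F s (x s))
    (hy : ∀ t ∈ Icc (0 : ℝ) 1, y t = x₀ + ∫ s in (0 : ℝ)..t, G s (y s))
    (h : ∀ t ∈ Icc (0 : ℝ) 1, ‖∫ s in (0 : ℝ)..t, (F s (y s) - G s (y s))‖ ≤ a) :
    ∀ t ∈ Icc (0 : ℝ) 1, ‖x t - y t‖ ≤ 2 * Real.exp (2 * K) * a := by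
  refine norm_le_of_norm_sub_integral_le (w := fun t => x t - y t)
    (g := fun s => F s (x s) - F s (y s))
    ((continuousOn_of_eq_add_integral hFx hx).sub (continuousOn_of_eq_add_integral hGy hy)) ha hK
    (fun t ht => ?_) (fun s hs => hlip s hs _ _)
  have h0 : (0 : ℝ) ∈ Icc (0 : ℝ) 1 := ⟨le_rfl, zero_le_one⟩
  convert h t ht using 2
  rw [hx t ht, hy t ht, intervalIntegral.integral_sub (hFx.mono_zero_one h0 ht)
    (hFy.mono_zero_one h0 ht), intervalIntegral.integral_sub (hFy.mono_zero_one h0 ht)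
    (hGy.mono_zero_one h0 ht)]
  abel

/-! ### Measurability and bounds of fields along curves -/

section Nemytskii

variable {X Y V : Type*} [NormedAddCommGroup X] [NormedAddCommGroup Y] [NormedAddCommGroup V]
  {G : ℝ → X → Y → V} {U : Set Y} {L : ℝ}

/-- `G` is controlled only over `[0,1]` and `U`, and `U` need not be measurable. A Lipschitz
extension to the whole space, available because `V` is finite-dimensional, is continuous and agrees
with `G` along the curve. -/
theorem aestronglyMeasurable_comp_of_lipschitz [NormedSpace ℝ V] [FiniteDimensional ℝ V]
    (hL : 0 ≤ L)
    (hG : ∀ t₁ ∈ Icc (0 : ℝ) 1, ∀ t₂ ∈ Icc (0 : ℝ) 1, ∀ x₁ x₂, ∀ u₁ ∈ U, ∀ u₂ ∈ U,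
      ‖G t₁ x₁ u₁ - G t₂ x₂ u₂‖ ≤ L * (|t₁ - t₂| + ‖x₁ - x₂‖ + ‖u₁ - u₂‖))
    {x : ℝ → X} (hx : ContinuousOn x (Icc 0 1)) {u : ℝ → Y}
    (hu : AEStronglyMeasurable u (volume.restrict (Icc (0 : ℝ) 1)))
    (huU : ∀ t ∈ Icc (0 : ℝ) 1, u t ∈ U) :
    AEStronglyMeasurable (fun s => G s (x s) (u s)) (volume.restrict (Icc (0 : ℝ) 1)) := by
  -- The product carries the max metric, and a sum of three distances is at most three times their
  -- maximum.
  have hlip : LipschitzOnWith (L * 3).toNNReal (fun p : ℝ × X × Y => G p.1 p.2.1 p.2.2)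
      (Icc (0 : ℝ) 1 ×ˢ univ ×ˢ U) := by
    refine LipschitzOnWith.of_dist_le_mul ?_
    rintro ⟨t₁, x₁, u₁⟩ ⟨ht₁, -, hu₁⟩ ⟨t₂, x₂, u₂⟩ ⟨ht₂, -, hu₂⟩
    rw [dist_eq_norm, Real.coe_toNNReal _ (by positivity), mul_assoc]
    refine (hG t₁ ht₁ t₂ ht₂ x₁ x₂ u₁ hu₁ u₂ hu₂).trans (mul_le_mul_of_nonneg_left ?_ hL)
    rw [← Real.norm_eq_abs, ← dist_eq_norm, ← dist_eq_norm, ← dist_eq_norm, Prod.dist_eq,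
      Prod.dist_eq]
    have h1 := le_max_left (dist t₁ t₂) (max (dist x₁ x₂) (dist u₁ u₂))
    have h2 := le_max_right (dist t₁ t₂) (max (dist x₁ x₂) (dist u₁ u₂))
    have h3 := le_max_left (dist x₁ x₂) (dist u₁ u₂)
    have h4 := le_max_right (dist x₁ x₂) (dist u₁ u₂)
    dsimp only
    linarith
  obtain ⟨g, hg, hgG⟩ := hlip.extend_finite_dimension
  have hm : AEStronglyMeasurable (fun s => g (s, x s, u s)) (volume.restrict (Icc (0 : ℝ) 1)) :=
    hg.continuous.comp_aestronglyMeasurable (aestronglyMeasurable_id.prodMk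
      ((hx.aestronglyMeasurable measurableSet_Icc).prodMk hu))
  refine hm.congr ((ae_restrict_iff' measurableSet_Icc).2 (Eventually.of_forall fun s hs => ?_))
  exact (hgG (x := (s, x s, u s)) ⟨hs, mem_univ _, huU s hs⟩).symm

theorem exists_bound_comp_of_lipschitz (hL : 0 ≤ L) (hU : Bornology.IsBounded U)
    (hG : ∀ t₁ ∈ Icc (0 : ℝ) 1, ∀ t₂ ∈ Icc (0 : ℝ) 1, ∀ x₁ x₂, ∀ u₁ ∈ U, ∀ u₂ ∈ U,
      ‖G t₁ x₁ u₁ - G t₂ x₂ u₂‖ ≤ L * (|t₁ - t₂| + ‖x₁ - x₂‖ + ‖u₁ - u₂‖))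
    {x : ℝ → X} (hx : ContinuousOn x (Icc 0 1)) :
    ∃ M, 0 ≤ M ∧ ∀ s ∈ Icc (0 : ℝ) 1, ∀ v ∈ U, ‖G s (x s) v‖ ≤ M := by
  rcases U.eq_empty_or_nonempty with rfl | ⟨u₀, hu₀⟩
  · exact ⟨0, le_rfl, fun s _ v hv => absurd hv (notMem_empty v)⟩
  obtain ⟨C, hC⟩ := isCompact_Icc.exists_bound_of_continuousOn hx
  obtain ⟨D, hD⟩ := hU.exists_norm_le
  have h0 : (0 : ℝ) ∈ Icc (0 : ℝ) 1 := ⟨le_rfl, zero_le_one⟩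
  have hb : ∀ s ∈ Icc (0 : ℝ) 1, ∀ v ∈ U,
      ‖G s (x s) v‖ ≤ ‖G 0 0 u₀‖ + L * (1 + C + (D + D)) := by
    intro s hs v hv
    have h1 := hG s hs 0 h0 (x s) 0 v hv u₀ hu₀
    have h2 : |s - 0| + ‖x s - 0‖ + ‖v - u₀‖ ≤ 1 + C + (D + D) := by
      have h3 : ‖v - u₀‖ ≤ D + D := (norm_sub_le _ _).trans (add_le_add (hD v hv) (hD u₀ hu₀))
      have h4 := hC s hs
      rw [sub_zero, sub_zero, abs_of_nonneg hs.1]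
      linarith [hs.2]
    have h5 := norm_le_norm_sub_add (G s (x s) v) (G 0 0 u₀)
    have h6 := mul_le_mul_of_nonneg_left h2 hL
    linarith
  exact ⟨_, (norm_nonneg _).trans (hb 0 h0 u₀ hu₀), hb⟩

end Nemytskii

/-! ### Simplices and admissible inputs -/

theorem pureSimplex_subset_relaxedSimplex (q : ℕ) : pureSimplex q ⊆ relaxedSimplex q := by
  rintro d ⟨h1, h2⟩
  refine ⟨fun i => ?_, h2⟩
  rcases h1 i with h | h <;> rw [h] <;> simp

theorem bvInputs_mono {k : ℕ} {Y Z : Set (EuclideanSpace ℝ (Fin k))} (h : Y ⊆ Z) :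
    bvInputs Y ⊆ bvInputs Z :=
  fun _ hv => ⟨fun t ht => h (hv.1 t ht), hv.2⟩

/-- Balls are convex. Thanks to this, Lipschitz constants and bounds of the modes pass to the
relaxed field without a factor `q`. -/
theorem norm_sum_smul_le_of_mem_relaxedSimplex {q : ℕ} {V : Type*} [NormedAddCommGroup V]
    [NormedSpace ℝ V] {d : EuclideanSpace ℝ (Fin q)} (hd : d ∈ relaxedSimplex q) {v : Fin q → V}
    {M : ℝ} (hv : ∀ i, ‖v i‖ ≤ M) : ‖∑ i, d i • v i‖ ≤ M := by
  calc ‖∑ i, d i • v i‖ ≤ ∑ i, d i * M := by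
        refine norm_sum_le_of_le _ fun i _ => ?_
        rw [norm_smul, Real.norm_of_nonneg (hd.1 i).1]
        exact mul_le_mul_of_nonneg_left (hv i) (hd.1 i).1
    _ = M := by rw [← Finset.sum_mul, hd.2, one_mul]

theorem norm_sum_sub_smul_le_of_mem_relaxedSimplex {q : ℕ} {V : Type*} [NormedAddCommGroup V]
    [NormedSpace ℝ V] {d d' : EuclideanSpace ℝ (Fin q)} (hd : d ∈ relaxedSimplex q)
    (hd' : d' ∈ relaxedSimplex q) {v : Fin q → V} {M : ℝ} (hv : ∀ i, ‖v i‖ ≤ M) :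
    ‖∑ i, (d' i - d i) • v i‖ ≤ 2 * M := by
  simp only [sub_smul, Finset.sum_sub_distrib]
  refine (norm_sub_le _ _).trans ?_
  have h1 := norm_sum_smul_le_of_mem_relaxedSimplex hd hv
  have h2 := norm_sum_smul_le_of_mem_relaxedSimplex hd' hv
  linarith

theorem aestronglyMeasurable_apply {k : ℕ} {Y : Set (EuclideanSpace ℝ (Fin k))}
    {v : ℝ → EuclideanSpace ℝ (Fin k)} (hv : v ∈ bvInputs Y) (i : Fin k) :
    AEStronglyMeasurable (fun s => v s i) (volume.restrict (Icc (0 : ℝ) 1)) :=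
  (EuclideanSpace.proj (𝕜 := ℝ) i).continuous.comp_aestronglyMeasurable hv.2.1.1

/-! ### Existence, uniqueness and stability of trajectories -/

namespace SwitchedSystem

variable {n m q Nc : ℕ} {S : SwitchedSystem n m q Nc} {L : ℝ}

theorem Xp_subset_Xr (S : SwitchedSystem n m q Nc) : S.Xp ⊆ S.Xr :=
  prod_mono_right (bvInputs_mono (pureSimplex_subset_relaxedSimplex q))

theorem RegularDynamics.lip_state (hf : S.RegularDynamics L) (i : Fin q) {t : ℝ}
    (ht : t ∈ Icc (0 : ℝ) 1) {u : EuclideanSpace ℝ (Fin m)} (hu : u ∈ S.U)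
    (x y : EuclideanSpace ℝ (Fin n)) : ‖S.f t x u i - S.f t y u i‖ ≤ L * ‖x - y‖ := by
  simpa using hf.lip_f i t ht t ht x y u hu u hu

theorem RegularDynamics.lip_field (hf : S.RegularDynamics L) {ξ : SwitchedInput m q}
    (hξ : ξ ∈ S.Xr) : ∀ s ∈ Icc (0 : ℝ) 1, ∀ x y : EuclideanSpace ℝ (Fin n),
      ‖S.field s x (ξ.1 s) (ξ.2 s) - S.field s y (ξ.1 s) (ξ.2 s)‖ ≤ L * ‖x - y‖ := by
  intro s hs x y
  simp only [field, ← Finset.sum_sub_distrib, ← smul_sub]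
  exact norm_sum_smul_le_of_mem_relaxedSimplex (hξ.2.1 s hs)
    fun i => hf.lip_state i hs (hξ.1.1 s hs) x y

theorem RegularDynamics.aestronglyMeasurable_mode (hf : S.RegularDynamics L) (hL : 0 ≤ L)
    {ξ : SwitchedInput m q} (hξ : ξ ∈ S.Xr) {x : ℝ → EuclideanSpace ℝ (Fin n)}
    (hx : ContinuousOn x (Icc 0 1)) (i : Fin q) :
    AEStronglyMeasurable (fun s => S.f s (x s) (ξ.1 s) i) (volume.restrict (Icc (0 : ℝ) 1)) :=
  aestronglyMeasurable_comp_of_lipschitz (G := fun s x u => S.f s x u i) hL (hf.lip_f i) hx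
    hξ.1.2.1.1 hξ.1.1

theorem RegularDynamics.exists_bound_mode (hf : S.RegularDynamics L) (hL : 0 ≤ L)
    (hU : Bornology.IsBounded S.U) {x : ℝ → EuclideanSpace ℝ (Fin n)}
    (hx : ContinuousOn x (Icc 0 1)) :
    ∃ M, 0 ≤ M ∧ ∀ i, ∀ s ∈ Icc (0 : ℝ) 1, ∀ v ∈ S.U, ‖S.f s (x s) v i‖ ≤ M := by
  choose M hM0 hM using fun i =>
    exists_bound_comp_of_lipschitz (G := fun s x u => S.f s x u i) hL hU (hf.lip_f i) hx
  refine ⟨∑ i, M i, Finset.sum_nonneg fun i _ => hM0 i, fun i s hs v hv => ?_⟩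
  exact (hM i s hs v hv).trans
    (Finset.single_le_sum (f := M) (fun j _ => hM0 j) (Finset.mem_univ i))

theorem RegularDynamics.intervalIntegrable_field (hf : S.RegularDynamics L) (hL : 0 ≤ L)
    (hU : Bornology.IsBounded S.U) {ξ : SwitchedInput m q} (hξ : ξ ∈ S.Xr)
    {x : ℝ → EuclideanSpace ℝ (Fin n)} (hx : ContinuousOn x (Icc 0 1)) :
    IntervalIntegrable (fun s => S.field s (x s) (ξ.1 s) (ξ.2 s)) volume 0 1 := by
  obtain ⟨M, -, hM⟩ := hf.exists_bound_mode hL hU hx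
  refine intervalIntegrable_zero_one_of_bound (M := M) ?_ fun s hs => ?_
  · simp only [field]
    exact Finset.aestronglyMeasurable_fun_sum _ fun i _ =>
      (aestronglyMeasurable_apply hξ.2 i).smul (hf.aestronglyMeasurable_mode hL hξ hx i)
  · exact norm_sum_smul_le_of_mem_relaxedSimplex (hξ.2.1 s hs)
      fun i => hM i s hs _ (hξ.1.1 s hs)

theorem IsTrajectory.continuousOn {ξ : SwitchedInput m q} {x : ℝ → EuclideanSpace ℝ (Fin n)}
    (hx : S.IsTrajectory ξ x) : ContinuousOn x (Icc 0 1) :=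
  continuousOn_of_eq_add_integral hx.1 hx.2

theorem RegularDynamics.isTrajectory_traj (hf : S.RegularDynamics L) (hL : 0 ≤ L)
    (hU : Bornology.IsBounded S.U) {ξ : SwitchedInput m q} (hξ : ξ ∈ S.Xr) :
    S.IsTrajectory ξ (S.traj ξ) := by
  obtain ⟨x, hxc, hx⟩ := exists_solution_of_lipschitz
    (F := fun s x => S.field s x (ξ.1 s) (ξ.2 s)) hL S.x₀
    (fun x hx => hf.intervalIntegrable_field hL hU hξ hx.continuousOn) (hf.lip_field hξ)
  exact Classical.epsilon_spec (p := S.IsTrajectory ξ)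
    ⟨x, hf.intervalIntegrable_field hL hU hξ hxc.continuousOn, hx⟩

theorem RegularDynamics.continuousOn_traj (hf : S.RegularDynamics L) (hL : 0 ≤ L)
    (hU : Bornology.IsBounded S.U) {ξ : SwitchedInput m q} (hξ : ξ ∈ S.Xr) :
    ContinuousOn (S.traj ξ) (Icc 0 1) :=
  (hf.isTrajectory_traj hL hU hξ).continuousOn

/-- Gap between two trajectories, in terms of the gap of the vector fields along the second. -/
theorem RegularDynamics.norm_traj_sub_le (hf : S.RegularDynamics L) (hL : 0 ≤ L)
    (hU : Bornology.IsBounded S.U) {ξ η : SwitchedInput m q} (hξ : ξ ∈ S.Xr)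
    {x y : ℝ → EuclideanSpace ℝ (Fin n)} (hx : S.IsTrajectory ξ x) (hy : S.IsTrajectory η y)
    {a : ℝ} (ha : 0 ≤ a)
    (h : ∀ t ∈ Icc (0 : ℝ) 1, ‖∫ s in (0 : ℝ)..t,
      (S.field s (y s) (ξ.1 s) (ξ.2 s) - S.field s (y s) (η.1 s) (η.2 s))‖ ≤ a) :
    ∀ t ∈ Icc (0 : ℝ) 1, ‖x t - y t‖ ≤ 2 * Real.exp (2 * L) * a :=
  norm_solution_sub_le (F := fun s x => S.field s x (ξ.1 s) (ξ.2 s))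
    (G := fun s x => S.field s x (η.1 s) (η.2 s)) hL ha (hf.lip_field hξ) hx.1
    (hf.intervalIntegrable_field hL hU hξ hy.continuousOn) hy.1 hx.2 hy.2 h

/-- Uniqueness is the stability estimate for two equal inputs, where the gap of the fields is zero.
-/
theorem RegularDynamics.eqOn_traj (hf : S.RegularDynamics L) (hL : 0 ≤ L)
    (hU : Bornology.IsBounded S.U) {ξ : SwitchedInput m q} (hξ : ξ ∈ S.Xr)
    {y : ℝ → EuclideanSpace ℝ (Fin n)} (hy : S.IsTrajectory ξ y) :
    EqOn y (S.traj ξ) (Icc 0 1) := by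
  intro t ht
  have h := hf.norm_traj_sub_le hL hU hξ hy (hf.isTrajectory_traj hL hU hξ) le_rfl
    (by simp) t ht
  rw [mul_zero] at h
  exact sub_eq_zero.1 (norm_le_zero_iff.1 h)

end SwitchedSystem

/-! ### Convexity of the input spaces and Taylor estimates -/

theorem BoundedVariationOn.add {α E : Type*} [LinearOrder α] [SeminormedAddCommGroup E]
    {f g : α → E} {s : Set α} (hf : BoundedVariationOn f s) (hg : BoundedVariationOn g s) :
    BoundedVariationOn (f + g) s := by
  refine ne_top_of_le_ne_top (ENNReal.add_ne_top.2 ⟨hf, hg⟩) (iSup_le ?_)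
  rintro ⟨k, u, hu, us⟩
  calc ∑ i ∈ Finset.range k, edist ((f + g) (u (i + 1))) ((f + g) (u i))
      ≤ ∑ i ∈ Finset.range k, (edist (f (u (i + 1))) (f (u i)) + edist (g (u (i + 1))) (g (u i))) :=
        Finset.sum_le_sum fun i _ => edist_add_add_le _ _ _ _
    _ ≤ _ := by
        rw [Finset.sum_add_distrib]
        exact add_le_add (eVariationOn.sum_le hu us) (eVariationOn.sum_le hu us)

theorem BoundedVariationOn.const_smul {α E : Type*} [LinearOrder α] [NormedAddCommGroup E]
    [NormedSpace ℝ E] {f : α → E} {s : Set α} (hf : BoundedVariationOn f s) (c : ℝ) :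
    BoundedVariationOn (c • f) s :=
  (lipschitzWith_smul c).comp_boundedVariationOn hf

theorem convex_bvInputs {k : ℕ} {Y : Set (EuclideanSpace ℝ (Fin k))} (hY : Convex ℝ Y) :
    Convex ℝ (bvInputs Y) := by
  intro v hv w hw a b ha hb hab
  exact ⟨fun t ht => hY (hv.1 t ht) (hw.1 t ht) ha hb hab,
    (hv.2.1.const_smul a).add (hw.2.1.const_smul b),
    (hv.2.2.const_smul a).add (hw.2.2.const_smul b)⟩

theorem convex_relaxedSimplex (q : ℕ) : Convex ℝ (relaxedSimplex q) := by
  intro v hv w hw a b ha hb hab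
  refine ⟨fun i => ?_, ?_⟩
  · exact convex_Icc (0 : ℝ) 1 (hv.1 i) (hw.1 i) ha hb hab
  · simp [Finset.sum_add_distrib, ← Finset.mul_sum, hv.2, hw.2, hab]

/-- First-order Taylor estimate for a function with Lipschitz derivative. -/
theorem Convex.norm_taylor_sub_le {V W : Type*} [NormedAddCommGroup V] [NormedSpace ℝ V]
    [NormedAddCommGroup W] [NormedSpace ℝ W] {g : V → W} {s : Set V} {L : ℝ} (hL : 0 ≤ L)
    (hs : Convex ℝ s) (hd : ∀ x ∈ s, DifferentiableAt ℝ g x)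
    (hlip : ∀ x ∈ s, ∀ y ∈ s, ‖fderiv ℝ g x - fderiv ℝ g y‖ ≤ L * ‖x - y‖) {x y : V}
    (hx : x ∈ s) (hy : y ∈ s) :
    ‖g y - g x - fderiv ℝ g x (y - x)‖ ≤ L * ‖y - x‖ * ‖y - x‖ := by
  have hseg := hs.segment_subset hx hy
  refine (convex_segment x y).norm_image_sub_le_of_norm_fderiv_le' (fun w hw => hd w (hseg hw))
    (fun w hw => (hlip w (hseg hw) x hx).trans ?_) (left_mem_segment ℝ x y)
    (right_mem_segment ℝ x y)
  refine mul_le_mul_of_nonneg_left ?_ hL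
  obtain ⟨a, b, ha, hb, hab, rfl⟩ := hw
  have h1 : a • x + b • y - x = b • (y - x) := by
    rw [eq_sub_of_add_eq hab]; module
  rw [h1, norm_smul, Real.norm_of_nonneg hb]
  exact mul_le_of_le_one_left (norm_nonneg _) (by linarith)

namespace SwitchedSystem

variable {n m q Nc : ℕ} {S : SwitchedSystem n m q Nc} {L : ℝ}

theorem convex_Xr (hU : Convex ℝ S.U) : Convex ℝ S.Xr :=
  (convex_bvInputs hU).prod (convex_bvInputs (convex_relaxedSimplex q))

/-- Only partial derivatives are given, so the increment is split: first `x` moves with the input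
fixed at `v`, then the input moves with `x` fixed. The state derivative is then taken at `v` instead
of `u`, which costs a product term by its Lipschitz bound. -/
theorem RegularDynamics.norm_mode_taylor_le (hf : S.RegularDynamics L) (hL : 0 ≤ L)
    (hU : Convex ℝ S.U) (i : Fin q) {t : ℝ} (ht : t ∈ Icc (0 : ℝ) 1)
    {u v : EuclideanSpace ℝ (Fin m)} (hu : u ∈ S.U) (hv : v ∈ S.U)
    (x y : EuclideanSpace ℝ (Fin n)) :
    ‖S.f t y v i - S.f t x u i - (fderiv ℝ (fun w => S.f t w u i) x (y - x)
      + fderiv ℝ (fun w => S.f t x w i) u (v - u))‖ ≤ L * (‖y - x‖ + ‖v - u‖) ^ 2 := by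
  have h1 := convex_univ.norm_taylor_sub_le (g := fun w => S.f t w v i) hL
    (fun w _ => hf.diff_x i t ht w v hv)
    (fun w _ z _ => by simpa using hf.lip_dx i t ht t ht w z v hv v hv) (mem_univ x) (mem_univ y)
  have h2 := hU.norm_taylor_sub_le (g := fun w => S.f t x w i) hL
    (fun w hw => hf.diff_u i t ht x w hw)
    (fun w hw z hz => by simpa using hf.lip_du i t ht t ht x x w hw z hz) hu hv
  have h3 : ‖(fderiv ℝ (fun w => S.f t w v i) x - fderiv ℝ (fun w => S.f t w u i) x) (y - x)‖
      ≤ L * ‖v - u‖ * ‖y - x‖ :=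
    ContinuousLinearMap.le_of_opNorm_le _
      (by simpa using hf.lip_dx i t ht t ht x x v hv u hu) _
  have e : S.f t y v i - S.f t x u i - (fderiv ℝ (fun w => S.f t w u i) x (y - x)
      + fderiv ℝ (fun w => S.f t x w i) u (v - u))
      = (S.f t y v i - S.f t x v i - fderiv ℝ (fun w => S.f t w v i) x (y - x))
      + (S.f t x v i - S.f t x u i - fderiv ℝ (fun w => S.f t x w i) u (v - u))
      + (fderiv ℝ (fun w => S.f t w v i) x - fderiv ℝ (fun w => S.f t w u i) x) (y - x) := by
    rw [_root_.sub_apply]; abel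
  rw [e]
  refine (norm_add₃_le).trans ((add_le_add (add_le_add h1 h2) h3).trans ?_)
  have h4 : 0 ≤ L * (‖v - u‖ * ‖y - x‖) := by positivity
  nlinarith

/-- The field is affine in `d`, so moving `d` adds to the remainder only `l` times an increment of
the modes. -/
theorem RegularDynamics.norm_field_taylor_le (hf : S.RegularDynamics L) (hL : 0 ≤ L)
    (hU : Convex ℝ S.U) {t : ℝ} (ht : t ∈ Icc (0 : ℝ) 1)
    {u v : EuclideanSpace ℝ (Fin m)} (hu : u ∈ S.U) (hv : v ∈ S.U)
    {d d' : EuclideanSpace ℝ (Fin q)} (hd : d ∈ relaxedSimplex q) (hd' : d' ∈ relaxedSimplex q)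
    (x y : EuclideanSpace ℝ (Fin n)) {l : ℝ} (hl : 0 ≤ l) :
    ‖S.field t y v (d + l • (d' - d)) - S.field t x u d
      - ∑ i, d i • (fderiv ℝ (fun w => S.f t w u i) x (y - x)
        + fderiv ℝ (fun w => S.f t x w i) u (v - u))
      - l • ∑ i, (d' i - d i) • S.f t x u i‖
      ≤ L * (‖y - x‖ + ‖v - u‖) ^ 2 + l * (2 * (L * (‖y - x‖ + ‖v - u‖))) := by
  have e : S.field t y v (d + l • (d' - d)) - S.field t x u d
      - ∑ i, d i • (fderiv ℝ (fun w => S.f t w u i) x (y - x)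
        + fderiv ℝ (fun w => S.f t x w i) u (v - u))
      - l • ∑ i, (d' i - d i) • S.f t x u i
      = ∑ i, d i • (S.f t y v i - S.f t x u i - (fderiv ℝ (fun w => S.f t w u i) x (y - x)
        + fderiv ℝ (fun w => S.f t x w i) u (v - u)))
      + l • ∑ i, (d' i - d i) • (S.f t y v i - S.f t x u i) := by
    simp only [field, Finset.smul_sum, ← Finset.sum_sub_distrib, ← Finset.sum_add_distrib]
    refine Finset.sum_congr rfl fun i _ => ?_
    simp only [PiLp.add_apply, PiLp.smul_apply, PiLp.sub_apply, smul_eq_mul]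
    module
  rw [e]
  refine (norm_add_le _ _).trans (add_le_add ?_ ?_)
  · exact norm_sum_smul_le_of_mem_relaxedSimplex hd
      fun i => hf.norm_mode_taylor_le hL hU i ht hu hv x y
  · rw [norm_smul, Real.norm_of_nonneg hl]
    refine mul_le_mul_of_nonneg_left ?_ hl
    exact norm_sum_sub_smul_le_of_mem_relaxedSimplex hd hd'
      fun i => by simpa using hf.lip_f i t ht t ht y x v hv u hu

/-- The state coefficient of the linearization along the trajectory of `ξ`. -/
noncomputable def linState (S : SwitchedSystem n m q Nc) (ξ : SwitchedInput m q) (s : ℝ) :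
    EuclideanSpace ℝ (Fin n) →L[ℝ] EuclideanSpace ℝ (Fin n) :=
  ∑ i, ξ.2 s i • fderiv ℝ (fun y => S.f s y (ξ.1 s) i) (S.traj ξ s)

/-- The inhomogeneity of the linearization along the trajectory of `ξ` in the direction
`ξ' - ξ`. -/
noncomputable def linInput (S : SwitchedSystem n m q Nc) (ξ ξ' : SwitchedInput m q) (s : ℝ) :
    EuclideanSpace ℝ (Fin n) :=
  ∑ i, ξ.2 s i • fderiv ℝ (fun v => S.f s (S.traj ξ s) v i) (ξ.1 s) (ξ'.1 s - ξ.1 s)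
    + ∑ i, (ξ'.2 s i - ξ.2 s i) • S.f s (S.traj ξ s) (ξ.1 s) i

theorem RegularDynamics.norm_linState_le (hf : S.RegularDynamics L) (hL : 0 ≤ L)
    {ξ : SwitchedInput m q} (hξ : ξ ∈ S.Xr) {s : ℝ} (hs : s ∈ Icc (0 : ℝ) 1) :
    ‖S.linState ξ s‖ ≤ L := by
  refine norm_sum_smul_le_of_mem_relaxedSimplex (hξ.2.1 s hs) fun i => ?_
  refine norm_fderiv_le_of_lip' ℝ hL (Eventually.of_forall fun y => ?_)
  exact hf.lip_state i hs (hξ.1.1 s hs) _ _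

theorem RegularDynamics.aestronglyMeasurable_linState (hf : S.RegularDynamics L) (hL : 0 ≤ L)
    (hU : Bornology.IsBounded S.U) {ξ : SwitchedInput m q} (hξ : ξ ∈ S.Xr) :
    AEStronglyMeasurable (S.linState ξ) (volume.restrict (Icc (0 : ℝ) 1)) :=
  Finset.aestronglyMeasurable_fun_sum _ fun i _ =>
    (aestronglyMeasurable_apply hξ.2 i).smul
      (aestronglyMeasurable_comp_of_lipschitz
        (G := fun s x u => fderiv ℝ (fun y => S.f s y u i) x) hL (hf.lip_dx i)
        (hf.continuousOn_traj hL hU hξ) hξ.1.2.1.1 hξ.1.1)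

theorem RegularDynamics.aestronglyMeasurable_linInput (hf : S.RegularDynamics L) (hL : 0 ≤ L)
    (hU : Bornology.IsBounded S.U) {ξ ξ' : SwitchedInput m q} (hξ : ξ ∈ S.Xr) (hξ' : ξ' ∈ S.Xr) :
    AEStronglyMeasurable (S.linInput ξ ξ') (volume.restrict (Icc (0 : ℝ) 1)) := by
  have hx := hf.continuousOn_traj hL hU hξ
  refine AEStronglyMeasurable.add (Finset.aestronglyMeasurable_fun_sum _ fun i _ => ?_)
    (Finset.aestronglyMeasurable_fun_sum _ fun i _ => ?_)
  · refine (aestronglyMeasurable_apply hξ.2 i).smul ?_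
    have h1 := aestronglyMeasurable_comp_of_lipschitz
        (G := fun s x u => fderiv ℝ (fun v => S.f s x v i) u) hL (hf.lip_du i)
        hx hξ.1.2.1.1 hξ.1.1
    exact isBoundedBilinearMap_apply.continuous.comp_aestronglyMeasurable
      (h1.prodMk (hξ'.1.2.1.1.sub hξ.1.2.1.1))
  · exact ((aestronglyMeasurable_apply hξ'.2 i).sub (aestronglyMeasurable_apply hξ.2 i)).smul
      (hf.aestronglyMeasurable_mode hL hξ hx i)

/-- The bound must not depend on `ξ'`: it is the source of the lower bound on `ζ(ξ, ·)` that makes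
`θ(ξ)` finite. -/
theorem RegularDynamics.exists_bound_linInput (hf : S.RegularDynamics L) (hL : 0 ≤ L)
    (hU : Bornology.IsBounded S.U) {ξ : SwitchedInput m q} (hξ : ξ ∈ S.Xr) :
    ∃ M, 0 ≤ M ∧ ∀ ξ' ∈ S.Xr, ∀ s ∈ Icc (0 : ℝ) 1, ‖S.linInput ξ ξ' s‖ ≤ M := by
  have hx := hf.continuousOn_traj hL hU hξ
  obtain ⟨M, hM0, hM⟩ := hf.exists_bound_mode hL hU hx
  choose N hN0 hN using fun i => exists_bound_comp_of_lipschitz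
    (G := fun s x u => fderiv ℝ (fun v => S.f s x v i) u) hL hU (hf.lip_du i) hx
  obtain ⟨R, hR0, hR⟩ := hU.exists_pos_norm_le
  refine ⟨(∑ i, N i) * (R + R) + 2 * M,
    add_nonneg (mul_nonneg (Finset.sum_nonneg fun i _ => hN0 i) (by positivity)) (by positivity),
    fun ξ' hξ' s hs => (norm_add_le _ _).trans (add_le_add ?_ ?_)⟩
  · refine norm_sum_smul_le_of_mem_relaxedSimplex (hξ.2.1 s hs) fun i => ?_
    have h1 : ‖fderiv ℝ (fun v => S.f s (S.traj ξ s) v i) (ξ.1 s)‖ ≤ ∑ i, N i :=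
      (hN i s hs _ (hξ.1.1 s hs)).trans
        (Finset.single_le_sum (f := N) (fun j _ => hN0 j) (Finset.mem_univ i))
    refine ContinuousLinearMap.le_of_opNorm_le_of_le _ h1 ((norm_sub_le _ _).trans ?_)
    exact add_le_add (hR _ (hξ'.1.1 s hs)) (hR _ (hξ.1.1 s hs))
  · exact norm_sum_sub_smul_le_of_mem_relaxedSimplex (hξ.2.1 s hs) (hξ'.2.1 s hs)
      fun i => hM i s hs _ (hξ.1.1 s hs)

theorem RegularDynamics.intervalIntegrable_linState_apply (hf : S.RegularDynamics L) (hL : 0 ≤ L)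
    (hU : Bornology.IsBounded S.U) {ξ : SwitchedInput m q} (hξ : ξ ∈ S.Xr)
    {z : ℝ → EuclideanSpace ℝ (Fin n)} (hz : ContinuousOn z (Icc 0 1)) :
    IntervalIntegrable (fun s => S.linState ξ s (z s)) volume 0 1 := by
  obtain ⟨C, hC⟩ := isCompact_Icc.exists_bound_of_continuousOn hz
  refine intervalIntegrable_zero_one_of_bound (M := L * C) ?_ fun s hs => ?_
  · exact isBoundedBilinearMap_apply.continuous.comp_aestronglyMeasurable
      ((hf.aestronglyMeasurable_linState hL hU hξ).prodMk
        (hz.aestronglyMeasurable measurableSet_Icc))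
  · exact ContinuousLinearMap.le_of_opNorm_le_of_le _ (hf.norm_linState_le hL hξ hs) (hC s hs)

theorem RegularDynamics.intervalIntegrable_linInput (hf : S.RegularDynamics L) (hL : 0 ≤ L)
    (hU : Bornology.IsBounded S.U) {ξ ξ' : SwitchedInput m q} (hξ : ξ ∈ S.Xr) (hξ' : ξ' ∈ S.Xr) :
    IntervalIntegrable (S.linInput ξ ξ') volume 0 1 := by
  obtain ⟨M, -, hM⟩ := hf.exists_bound_linInput hL hU hξ
  exact intervalIntegrable_zero_one_of_bound (hf.aestronglyMeasurable_linInput hL hU hξ hξ')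
    (hM ξ' hξ')

theorem RegularDynamics.exists_linearization (hf : S.RegularDynamics L) (hL : 0 ≤ L)
    (hU : Bornology.IsBounded S.U) {ξ ξ' : SwitchedInput m q} (hξ : ξ ∈ S.Xr) (hξ' : ξ' ∈ S.Xr) :
    ∃ z : ℝ → EuclideanSpace ℝ (Fin n), Continuous z ∧ ∀ t ∈ Icc (0 : ℝ) 1,
      z t = ∫ s in (0 : ℝ)..t, (S.linState ξ s (z s) + S.linInput ξ ξ' s) := by
  obtain ⟨z, hzc, hz⟩ := exists_solution_of_lipschitz
    (F := fun s z => S.linState ξ s z + S.linInput ξ ξ' s) hL 0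
    (fun z hz => (hf.intervalIntegrable_linState_apply hL hU hξ hz.continuousOn).add
      (hf.intervalIntegrable_linInput hL hU hξ hξ')) (fun s hs x y => by
        rw [add_sub_add_right_eq_sub, ← map_sub]
        exact ContinuousLinearMap.le_of_opNorm_le _ (hf.norm_linState_le hL hξ hs) _)
  exact ⟨z, hzc, fun t ht => by simpa using hz t ht⟩

/-- First-order expansion of the trajectory under a convex perturbation of the input, uniformly in
time, with a bound on the first-order term that is uniform in the perturbation. -/
theorem RegularDynamics.exists_traj_expansion (hf : S.RegularDynamics L) (hL : 0 ≤ L)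
    (hUb : Bornology.IsBounded S.U) (hUc : Convex ℝ S.U) {ξ : SwitchedInput m q} (hξ : ξ ∈ S.Xr) :
    ∃ B, 0 ≤ B ∧ ∀ ξ' ∈ S.Xr, ∃ z : ℝ → EuclideanSpace ℝ (Fin n), Continuous z ∧
      (∀ t ∈ Icc (0 : ℝ) 1, ‖z t‖ ≤ B) ∧ ∃ C, 0 ≤ C ∧ ∀ l ∈ Icc (0 : ℝ) 1, ∀ t ∈ Icc (0 : ℝ) 1,
        ‖S.traj (ξ + l • (ξ' - ξ)) t - S.traj ξ t‖ ≤ C * l ∧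
        ‖S.traj (ξ + l • (ξ' - ξ)) t - S.traj ξ t - l • z t‖ ≤ C * l ^ 2 := by
  obtain ⟨M, hM0, hM⟩ := hf.exists_bound_linInput hL hUb hξ
  have hx := hf.isTrajectory_traj hL hUb hξ
  obtain ⟨N, hN0, hN⟩ := hf.exists_bound_mode hL hUb hx.continuousOn
  obtain ⟨R, hR0, hR⟩ := hUb.exists_pos_norm_le
  have h0 : (0 : ℝ) ∈ Icc (0 : ℝ) 1 := ⟨le_rfl, zero_le_one⟩
  refine ⟨2 * Real.exp (2 * L) * M, by positivity, fun ξ' hξ' => ?_⟩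
  obtain ⟨z, hzc, hz⟩ := hf.exists_linearization hL hUb hξ hξ'
  have hiA := hf.intervalIntegrable_linState_apply hL hUb hξ hzc.continuousOn
  have hib := hf.intervalIntegrable_linInput hL hUb hξ hξ'
  set x := S.traj ξ with hxdef
  refine ⟨z, hzc, ?_, ?_⟩
  · refine norm_le_of_norm_sub_integral_le (g := fun s => S.linState ξ s (z s)) hzc.continuousOn
      hM0 hL (fun t ht => ?_)
      (fun s hs => ContinuousLinearMap.le_of_opNorm_le _ (hf.norm_linState_le hL hξ hs) _)
    rw [hz t ht, ← intervalIntegral.integral_sub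
      ((hiA.add hib).mono_zero_one h0 ht) (hiA.mono_zero_one h0 ht)]
    simp only [add_sub_cancel_left]
    exact norm_integral_le_of_bound (hM ξ' hξ') t ht
  -- Along `x` the field changes by at most `L * 2R * l` through `u` and `2N * l` through `d`; the
  -- exponential is Grönwall's factor.
  set C₁ := 2 * Real.exp (2 * L) * (L * (2 * R) + 2 * N) with hC₁
  have hC₁0 : 0 ≤ C₁ := by positivity
  -- The Taylor remainder of the field when state and input together move by at most `(C₁ + 2R) l`,
  -- divided by `l²`.
  set C₂ := L * (C₁ + 2 * R) ^ 2 + 2 * (L * (C₁ + 2 * R)) with hC₂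
  have hC₂0 : 0 ≤ C₂ := by positivity
  refine ⟨C₁ + 2 * Real.exp (2 * L) * C₂, by positivity, fun l hl => ?_⟩
  have hξl : ξ + l • (ξ' - ξ) ∈ S.Xr := (convex_Xr hUc).add_smul_sub_mem hξ hξ' hl
  set η := ξ + l • (ξ' - ξ) with hη
  have hy := hf.isTrajectory_traj hL hUb hξl
  set y := S.traj η with hydef
  have hη1 : ∀ s, η.1 s - ξ.1 s = l • (ξ'.1 s - ξ.1 s) := fun s => by simp [hη]
  have hη2 : ∀ s, η.2 s = ξ.2 s + l • (ξ'.2 s - ξ.2 s) := fun s => by simp [hη]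
  have hηn : ∀ s ∈ Icc (0 : ℝ) 1, ‖η.1 s - ξ.1 s‖ ≤ 2 * R * l := by
    intro s hs
    rw [hη1, norm_smul, Real.norm_of_nonneg hl.1, mul_comm]
    refine mul_le_mul_of_nonneg_right ((norm_sub_le _ _).trans ?_) hl.1
    linarith [hR _ (hξ'.1.1 s hs), hR _ (hξ.1.1 s hs)]
  have hδ : ∀ t ∈ Icc (0 : ℝ) 1, ‖y t - x t‖ ≤ C₁ * l := by
    intro t ht
    have := hf.norm_traj_sub_le hL hUb hξl hy hx (a := (L * (2 * R) + 2 * N) * l)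
      (by have := hl.1; positivity) (norm_integral_le_of_bound fun s hs => ?_) t ht
    · rwa [← mul_assoc] at this
    have e : S.field s (x s) (η.1 s) (η.2 s) - S.field s (x s) (ξ.1 s) (ξ.2 s)
        = ∑ i, η.2 s i • (S.f s (x s) (η.1 s) i - S.f s (x s) (ξ.1 s) i)
        + l • ∑ i, (ξ'.2 s i - ξ.2 s i) • S.f s (x s) (ξ.1 s) i := by
      simp only [field, hη2, Finset.smul_sum, ← Finset.sum_sub_distrib, ← Finset.sum_add_distrib]
      refine Finset.sum_congr rfl fun i _ => ?_
      simp only [PiLp.add_apply, PiLp.smul_apply, PiLp.sub_apply, smul_eq_mul]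
      module
    rw [e]
    refine (norm_add_le _ _).trans ?_
    rw [add_mul]
    refine add_le_add ?_ ?_
    · refine norm_sum_smul_le_of_mem_relaxedSimplex (hξl.2.1 s hs) fun i => ?_
      have h1 := hf.lip_f i s hs s hs (x s) (x s) _ (hξl.1.1 s hs) _ (hξ.1.1 s hs)
      simp only [sub_self, abs_zero, norm_zero, zero_add] at h1
      rw [mul_assoc]
      exact h1.trans (mul_le_mul_of_nonneg_left (hηn s hs) hL)
    · rw [norm_smul, Real.norm_of_nonneg hl.1, mul_comm]
      exact mul_le_mul_of_nonneg_right (norm_sum_sub_smul_le_of_mem_relaxedSimplex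
        (hξ.2.1 s hs) (hξ'.2.1 s hs) fun i => hN i s hs _ (hξ.1.1 s hs)) hl.1
  have hexp : ∀ t ∈ Icc (0 : ℝ) 1,
      ‖y t - x t - l • z t‖ ≤ 2 * Real.exp (2 * L) * (C₂ * l ^ 2) := by
    have hwc : ContinuousOn (fun t => y t - x t - l • z t) (Icc 0 1) :=
      (hy.continuousOn.sub hx.continuousOn).sub (hzc.continuousOn.const_smul l)
    have hiw := hf.intervalIntegrable_linState_apply hL hUb hξ hwc
    refine norm_le_of_norm_sub_integral_le (g := fun s => S.linState ξ s (y s - x s - l • z s))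
      hwc (by positivity) hL (fun t ht => ?_)
      (fun s hs => ContinuousLinearMap.le_of_opNorm_le _ (hf.norm_linState_le hL hξ hs) _)
    -- The error `w = y - x - l z` solves the homogeneous variational equation up to a forcing term,
    -- identified below as the Taylor remainder of the field.
    have e : y t - x t - l • z t - ∫ s in (0 : ℝ)..t, S.linState ξ s (y s - x s - l • z s)
        = ∫ s in (0 : ℝ)..t, (S.field s (y s) (η.1 s) (η.2 s) - S.field s (x s) (ξ.1 s) (ξ.2 s)
          - l • (S.linState ξ s (z s) + S.linInput ξ ξ' s)
          - S.linState ξ s (y s - x s - l • z s)) := by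
      have i1 := hy.1.mono_zero_one h0 ht
      have i2 := hx.1.mono_zero_one h0 ht
      have i3 := (hiA.add hib).mono_zero_one h0 ht
      have i4 : IntervalIntegrable
        (fun s => l • (S.linState ξ s (z s) + S.linInput ξ ξ' s)) volume 0 t := i3.smul l
      rw [intervalIntegral.integral_sub ((i1.sub i2).sub i4) (hiw.mono_zero_one h0 ht),
        intervalIntegral.integral_sub (i1.sub i2) i4,
        intervalIntegral.integral_sub i1 i2, intervalIntegral.integral_smul, ← hz t ht,
        hy.2 t ht, hx.2 t ht, add_sub_add_left_eq_sub]
    rw [e]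
    refine norm_integral_le_of_bound (fun s hs => ?_) t ht
    have h1 := hf.norm_field_taylor_le hL hUc hs (hξ.1.1 s hs) (hξl.1.1 s hs) (hξ.2.1 s hs)
      (hξ'.2.1 s hs) (x s) (y s) hl.1
    rw [← hη2] at h1
    have e2 : S.field s (y s) (η.1 s) (η.2 s) - S.field s (x s) (ξ.1 s) (ξ.2 s)
          - l • (S.linState ξ s (z s) + S.linInput ξ ξ' s)
          - S.linState ξ s (y s - x s - l • z s)
        = S.field s (y s) (η.1 s) (η.2 s) - S.field s (x s) (ξ.1 s) (ξ.2 s)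
          - ∑ i, ξ.2 s i • (fderiv ℝ (fun w => S.f s w (ξ.1 s) i) (x s) (y s - x s)
            + fderiv ℝ (fun w => S.f s (x s) w i) (ξ.1 s) (η.1 s - ξ.1 s))
          - l • ∑ i, (ξ'.2 s i - ξ.2 s i) • S.f s (x s) (ξ.1 s) i := by
      have e3 : ∑ i, ξ.2 s i • (fderiv ℝ (fun w => S.f s w (ξ.1 s) i) (x s) (y s - x s)
            + fderiv ℝ (fun w => S.f s (x s) w i) (ξ.1 s) (η.1 s - ξ.1 s))
          = S.linState ξ s (y s - x s) + l • ∑ i, ξ.2 s i •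
            fderiv ℝ (fun w => S.f s (x s) w i) (ξ.1 s) (ξ'.1 s - ξ.1 s) := by
        simp only [hη1, map_smul, smul_add, Finset.sum_add_distrib, linState,
          _root_.sum_apply, _root_.smul_apply, Finset.smul_sum,
          smul_comm l, hxdef]
      rw [e3, map_sub, map_smul, linInput, ← hxdef]
      module
    rw [e2]
    refine h1.trans ?_
    have h2 : ‖y s - x s‖ + ‖η.1 s - ξ.1 s‖ ≤ (C₁ + 2 * R) * l := by
      linarith [hδ s hs, hηn s hs]
    have hl0 := hl.1
    calc L * (‖y s - x s‖ + ‖η.1 s - ξ.1 s‖) ^ 2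
          + l * (2 * (L * (‖y s - x s‖ + ‖η.1 s - ξ.1 s‖)))
        ≤ L * ((C₁ + 2 * R) * l) ^ 2 + l * (2 * (L * ((C₁ + 2 * R) * l))) := by gcongr
      _ = C₂ * l ^ 2 := by rw [hC₂]; ring
  intro t ht
  have hl0 := hl.1
  constructor
  · refine (hδ t ht).trans (mul_le_mul_of_nonneg_right ?_ hl0)
    exact le_add_of_nonneg_right (by positivity)
  · refine (hexp t ht).trans ?_
    rw [← mul_assoc]
    exact mul_le_mul_of_nonneg_right (le_add_of_nonneg_left hC₁0) (by positivity)

end SwitchedSystem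

/-! ### Weak smallness of functions with small primitive -/

/-- A continuous function is nearly orthogonal to bounded functions with small primitive. -/
theorem ContinuousOn.eventually_norm_integral_smul_le {E : Type*} [NormedAddCommGroup E]
    [NormedSpace ℝ E] [CompleteSpace E] {g : ℝ → E} (hg : ContinuousOn g (Icc 0 1)) {ε : ℝ} (hε : 0 < ε) :
    ∀ᶠ δ in 𝓝[>] (0 : ℝ), ∀ w : ℝ → ℝ, IntervalIntegrable w volume 0 1 →
      (∀ s ∈ Icc (0 : ℝ) 1, |w s| ≤ 1) →
      (∀ t ∈ Icc (0 : ℝ) 1, |∫ s in (0 : ℝ)..t, w s| ≤ δ) →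
      ∀ t ∈ Icc (0 : ℝ) 1, ‖∫ s in (0 : ℝ)..t, w s • g s‖ ≤ ε := by
  obtain ⟨τ, hτ, hτg⟩ := Metric.uniformContinuousOn_iff_le.1
    (isCompact_Icc.uniformContinuousOn_of_continuous hg) (ε / 2) (by positivity)
  obtain ⟨C, hC⟩ := isCompact_Icc.exists_bound_of_continuousOn hg
  obtain ⟨N, hN⟩ := exists_nat_one_div_lt hτ
  have h0 : (0 : ℝ) ∈ Icc (0 : ℝ) 1 := ⟨le_rfl, zero_le_one⟩
  have hC0 : 0 ≤ C := (norm_nonneg _).trans (hC 0 h0)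
  have hN0 : (0 : ℝ) < N + 1 := by positivity
  have hδ : ∀ᶠ δ in 𝓝[>] (0 : ℝ), ((N : ℝ) + 1) * (2 * δ * C) < ε / 2 := by
    have hc : Tendsto (fun δ : ℝ => ((N : ℝ) + 1) * (2 * δ * C)) (𝓝 0) (𝓝 0) := by
      have : Continuous fun δ : ℝ => ((N : ℝ) + 1) * (2 * δ * C) := by fun_prop
      simpa using this.tendsto 0
    exact (hc.mono_left nhdsWithin_le_nhds).eventually (gt_mem_nhds (by positivity))
  filter_upwards [hδ] with δ hδ w hw hw1 hwδ
  have hwg : IntervalIntegrable (fun s => w s • g s) volume 0 1 :=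
    hw.smul_continuousOn (by rwa [uIcc_of_le zero_le_one])
  -- Induction over cells shorter than the modulus of continuity `τ`. Freezing `g` at the left end
  -- of a cell costs `ε/2` times its length, and the frozen part at most `2δC`, since the integral
  -- of `w` over a cell is a difference of two primitives.
  have key : ∀ k : ℕ, ∀ t ∈ Icc (0 : ℝ) 1, t ≤ k * (1 / ((N : ℝ) + 1)) →
      ‖∫ s in (0 : ℝ)..t, w s • g s‖ ≤ ε / 2 * t + k * (2 * δ * C) := by
    intro k
    induction k with
    | zero =>
      intro t ht htk
      have : t = 0 := le_antisymm (by simpa using htk) ht.1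
      simp [this]
    | succ k ih =>
      intro t ht htk
      have hδ0 : 0 ≤ δ := (abs_nonneg _).trans (hwδ 0 h0)
      have hnn : 0 ≤ 2 * δ * C := by positivity
      set a := (k : ℝ) * (1 / ((N : ℝ) + 1)) with ha
      rcases le_or_gt t a with hta | hta
      · refine (ih t ht hta).trans ?_
        push_cast
        linarith
      have ha0 : 0 ≤ a := by positivity
      have hta' : t - a ≤ τ := by
        push_cast at htk
        linarith
      have haI : a ∈ Icc (0 : ℝ) 1 := ⟨ha0, hta.le.trans ht.2⟩
      have hiw := hw.mono_zero_one haI ht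
      have hcst : IntervalIntegrable (fun s => w s • g a) volume a t :=
        hiw.smul_continuousOn continuousOn_const
      have hsplit : ∫ s in (0 : ℝ)..t, w s • g s = (∫ s in (0 : ℝ)..a, w s • g s)
          + ((∫ s in a..t, w s • (g s - g a)) + (∫ s in a..t, w s) • g a) := by
        rw [← intervalIntegral.integral_add_adjacent_intervals
          (hwg.mono_zero_one h0 haI) (hwg.mono_zero_one haI ht),
          ← intervalIntegral.integral_smul_const]
        simp only [smul_sub]
        rw [intervalIntegral.integral_sub (hwg.mono_zero_one haI ht) hcst, sub_add_cancel]
      have h1 : ‖∫ s in a..t, w s • (g s - g a)‖ ≤ ε / 2 * (t - a) := by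
        rw [← abs_of_pos (sub_pos.2 hta)]
        refine intervalIntegral.norm_integral_le_of_norm_le_const fun s hs => ?_
        rw [uIoc_of_le hta.le] at hs
        have hsI : s ∈ Icc (0 : ℝ) 1 := ⟨ha0.trans hs.1.le, hs.2.trans ht.2⟩
        rw [norm_smul, ← one_mul (ε / 2)]
        refine mul_le_mul (hw1 s hsI) ?_ (norm_nonneg _) zero_le_one
        rw [← dist_eq_norm]
        refine hτg s hsI a haI ?_
        rw [Real.dist_eq, abs_of_pos (sub_pos.2 hs.1)]
        linarith [hs.2]
      have h2 : ‖(∫ s in a..t, w s) • g a‖ ≤ 2 * δ * C := by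
        rw [norm_smul]
        refine mul_le_mul ?_ (hC a haI) (norm_nonneg _) (by positivity)
        rw [← intervalIntegral.integral_interval_sub_left (hw.mono_zero_one h0 ht)
          (hw.mono_zero_one h0 haI), two_mul]
        exact (norm_sub_le _ _).trans (add_le_add (hwδ t ht) (hwδ a haI))
      rw [hsplit]
      have h3 := ih a haI le_rfl
      refine (norm_add_le _ _).trans ((add_le_add h3 ((norm_add_le _ _).trans
        (add_le_add h1 h2))).trans (le_of_eq ?_))
      push_cast
      ring
  intro t ht
  refine (key (N + 1) t ht ?_).trans ?_
  · push_cast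
    rw [mul_one_div_cancel hN0.ne']
    exact ht.2
  · push_cast
    have := mul_le_mul_of_nonneg_left ht.2 (half_pos hε).le
    linarith

/-- An integrable function is nearly orthogonal to bounded functions with small primitive. -/
theorem IntervalIntegrable.eventually_norm_integral_smul_le {E : Type*} [NormedAddCommGroup E]
    [NormedSpace ℝ E] [CompleteSpace E] {g : ℝ → E} (hg : IntervalIntegrable g volume 0 1) {ε : ℝ} (hε : 0 < ε) :
    ∀ᶠ δ in 𝓝[>] (0 : ℝ), ∀ w : ℝ → ℝ, IntervalIntegrable w volume 0 1 →
      (∀ s ∈ Icc (0 : ℝ) 1, |w s| ≤ 1) →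
      (∀ t ∈ Icc (0 : ℝ) 1, |∫ s in (0 : ℝ)..t, w s| ≤ δ) →
      ∀ t ∈ Icc (0 : ℝ) 1, ‖∫ s in (0 : ℝ)..t, w s • g s‖ ≤ ε := by
  have hg' := hg
  rw [intervalIntegrable_iff_integrableOn_Ioc_of_le zero_le_one] at hg
  -- Since `|w| ≤ 1`, replacing `g` by an `L¹`-close continuous `c` costs at most `ε/2`, whatever
  -- `w` is.
  obtain ⟨c, hc, -⟩ := hg.exists_boundedContinuous_integral_sub_le (half_pos hε)
  filter_upwards [c.continuous.continuousOn.eventually_norm_integral_smul_le (half_pos hε)]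
    with δ hδ w hw hw1 hwδ t ht
  have h0 : (0 : ℝ) ∈ Icc (0 : ℝ) 1 := ⟨le_rfl, zero_le_one⟩
  have hci : IntervalIntegrable (⇑c) volume 0 1 := c.continuous.intervalIntegrable _ _
  have hd : IntervalIntegrable (fun s => g s - c s) volume 0 1 := hg'.sub hci
  have hwm : AEStronglyMeasurable w (volume.restrict (Ioc 0 1)) := hw.1.aestronglyMeasurable
  have hbd : ∀ {k : ℝ → E}, IntervalIntegrable k volume 0 1 →
      IntervalIntegrable (fun s => w s • k s) volume 0 1 := by
    intro k hk
    rw [intervalIntegrable_iff_integrableOn_Ioc_of_le zero_le_one] at hk ⊢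
    refine hk.norm.mono' (hwm.smul hk.aestronglyMeasurable) ?_
    refine (ae_restrict_iff' measurableSet_Ioc).2 (Eventually.of_forall fun s hs => ?_)
    rw [norm_smul]
    exact mul_le_of_le_one_left (norm_nonneg _) (hw1 s (Ioc_subset_Icc_self hs))
  have e : ∫ s in (0 : ℝ)..t, w s • g s
      = (∫ s in (0 : ℝ)..t, w s • (g s - c s)) + ∫ s in (0 : ℝ)..t, w s • c s := by
    rw [← intervalIntegral.integral_add ((hbd hd).mono_zero_one h0 ht)
      ((hbd hci).mono_zero_one h0 ht)]
    simp only [← smul_add, sub_add_cancel]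
  have h1 : ‖∫ s in (0 : ℝ)..t, w s • (g s - c s)‖ ≤ ε / 2 := by
    refine (intervalIntegral.norm_integral_le_of_norm_le (g := fun s => ‖g s - c s‖) ht.1
      (Eventually.of_forall fun s hs => ?_) (hd.mono_zero_one h0 ht).norm).trans ?_
    · rw [norm_smul]
      exact mul_le_of_le_one_left (norm_nonneg _) (hw1 s ⟨hs.1.le, hs.2.trans ht.2⟩)
    · rw [intervalIntegral.integral_of_le ht.1]
      refine le_trans ?_ hc
      refine setIntegral_mono_set (hg.sub hci.1).norm (Eventually.of_forall fun s => norm_nonneg _)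
        (Ioc_subset_Ioc_right ht.2).eventuallyLE
  rw [e]
  refine (norm_add_le _ _).trans ?_
  linarith [hδ w hw hw1 hwδ t ht]

/-! ### Sum-up rounding of relaxed discrete inputs -/

theorem intervalIntegrable_apply_of_mem_bvInputs {k : ℕ} {Y : Set (EuclideanSpace ℝ (Fin k))}
    {v : ℝ → EuclideanSpace ℝ (Fin k)} (hv : v ∈ bvInputs Y) (i : Fin k) :
    IntervalIntegrable (fun s => v s i) volume 0 1 := by
  rw [intervalIntegrable_iff_integrableOn_Icc_of_le zero_le_one]
  exact (EuclideanSpace.proj (𝕜 := ℝ) i).integrable_comp (hv.2.1.integrable one_le_two)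

theorem single_mem_pureSimplex {q : ℕ} (i : Fin q) :
    EuclideanSpace.single i (1 : ℝ) ∈ pureSimplex q := by
  refine ⟨fun j => ?_, ?_⟩
  · by_cases h : j = i <;> simp [h]
  · simp

/-- Switching to the constant `c` after time `T` keeps an input admissible. -/
theorem switch_mem_bvInputs {k : ℕ} {Y : Set (EuclideanSpace ℝ (Fin k))}
    {v : ℝ → EuclideanSpace ℝ (Fin k)} (hv : v ∈ bvInputs Y) {c : EuclideanSpace ℝ (Fin k)}
    (hc : c ∈ Y) (T : ℝ) : (fun t => if t ≤ T then v t else c) ∈ bvInputs Y := by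
  have e : (fun t => if t ≤ T then v t else c)
      = v + (Ioi T).indicator (fun t => c - v t) := by
    funext t
    by_cases h : t ≤ T <;> simp [h, indicator, ← not_le]
  -- As a product with a monotone step function, the correction has bounded variation.
  have e2 : (Ioi T).indicator (fun t => c - v t)
      = (Ioi T).indicator (fun _ => (1 : ℝ)) • ((fun _ => c) + (-1 : ℝ) • v) := by
    funext t
    by_cases h : t ≤ T <;> simp [h, indicator, ← not_le, sub_eq_add_neg]
  refine ⟨fun t ht => ?_, ?_, ?_⟩
  · dsimp only
    split_ifs
    exacts [hv.1 t ht, hc]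
  · rw [e]
    exact hv.2.1.add (((memLp_const c).sub hv.2.1).indicator measurableSet_Ioi)
  · rw [e, e2]
    have hmono : Monotone ((Ioi T).indicator fun _ => (1 : ℝ)) := by
      intro a b hab
      simp only [indicator, mem_Ioi]
      split_ifs with h1 h2
      · exact le_rfl
      · exact absurd (h1.trans_le hab) h2
      · exact zero_le_one
      · exact le_rfl
    have hφ : BoundedVariationOn ((Ioi T).indicator fun _ => (1 : ℝ)) (Icc 0 1) := by
      refine (hmono.monotoneOn _).boundedVariationOn (C := 1) fun t _ => ?_
      simp only [indicator]
      split_ifs <;> simp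
    have hcst : BoundedVariationOn (fun _ : ℝ => c) (Icc 0 1) := by
      rw [BoundedVariationOn, eVariationOn.constant_on]
      · simp
      · rintro _ ⟨_, -, rfl⟩ _ ⟨_, -, rfl⟩
        rfl
    exact hv.2.2.add (hφ.smul (hcst.add (hv.2.2.const_smul (-1))))

/-- Both inputs have coordinate sum one. The balance serves twice: it supplies a mode that may be
switched on, and it turns lower bounds on all deficits into upper ones. -/
theorem sum_integral_sub_eq_zero {q : ℕ} {d v : ℝ → EuclideanSpace ℝ (Fin q)}
    (hd : d ∈ bvInputs (relaxedSimplex q)) (hv : v ∈ bvInputs (relaxedSimplex q)) {t : ℝ}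
    (ht : t ∈ Icc (0 : ℝ) 1) : ∑ i, ∫ s in (0 : ℝ)..t, (d s i - v s i) = 0 := by
  have h0 : (0 : ℝ) ∈ Icc (0 : ℝ) 1 := ⟨le_rfl, zero_le_one⟩
  rw [← intervalIntegral.integral_finsetSum fun i _ =>
    ((intervalIntegrable_apply_of_mem_bvInputs hd i).sub
      (intervalIntegrable_apply_of_mem_bvInputs hv i)).mono_zero_one h0 ht]
  rw [intervalIntegral.integral_congr (g := fun _ => (0 : ℝ)), intervalIntegral.integral_zero]
  intro s hs
  rw [uIcc_of_le ht.1] at hs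
  have hs' : s ∈ Icc (0 : ℝ) 1 := ⟨hs.1, hs.2.trans ht.2⟩
  simp [Finset.sum_sub_distrib, (hd.1 s hs').2, (hv.1 s hs').2]

/-- Sum-up rounding: on each time slot choose a mode that is not ahead of the relaxed input. -/
theorem exists_pure_neg_le_integral_sub {q : ℕ} {d : ℝ → EuclideanSpace ℝ (Fin q)}
    (hd : d ∈ bvInputs (relaxedSimplex q)) {h : ℝ} (hh : 0 < h) (k : ℕ) :
    ∃ v ∈ bvInputs (pureSimplex q), ∀ t ∈ Icc (0 : ℝ) 1, t ≤ k * h →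
      ∀ i, -h ≤ ∫ s in (0 : ℝ)..t, (d s i - v s i) := by
  have h0 : (0 : ℝ) ∈ Icc (0 : ℝ) 1 := ⟨le_rfl, zero_le_one⟩
  have hq : Nonempty (Fin q) := by
    by_contra hne
    rw [not_nonempty_iff] at hne
    have := (hd.1 0 h0).2
    simp at this
  induction k with
  | zero =>
    refine ⟨fun _ => EuclideanSpace.single hq.some 1, ⟨fun _ _ => single_mem_pureSimplex _,
      memLp_const _, ?_⟩, fun t ht htk i => ?_⟩
    · rw [BoundedVariationOn, eVariationOn.constant_on]
      · simp
      · rintro _ ⟨_, -, rfl⟩ _ ⟨_, -, rfl⟩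
        rfl
    · have : t = 0 := le_antisymm (by simpa using htk) ht.1
      simp [this, hh.le]
  | succ k ih =>
    obtain ⟨v, hv, hvk⟩ := ih
    set T := (k : ℝ) * h with hT
    have hT0 : 0 ≤ T := by positivity
    rcases lt_or_ge 1 T with h1T | hT1
    · exact ⟨v, hv, fun t ht _ => hvk t ht (ht.2.trans h1T.le)⟩
    have hTI : T ∈ Icc (0 : ℝ) 1 := ⟨hT0, hT1⟩
    -- The deficits at `T` sum to zero, so some mode `j` has a nonnegative one. Running `j` until
    -- `t` lowers its deficit by at most `h`, while the other deficits do not decrease.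
    obtain ⟨j, -, hj⟩ := Finset.exists_le_of_sum_le (s := Finset.univ) Finset.univ_nonempty
      (f := fun _ : Fin q => (0 : ℝ)) (g := fun i => ∫ s in (0 : ℝ)..T, (d s i - v s i))
      (by rw [sum_integral_sub_eq_zero hd (bvInputs_mono (pureSimplex_subset_relaxedSimplex q) hv)
        hTI]; simp)
    have hv' := switch_mem_bvInputs hv (single_mem_pureSimplex j) T
    refine ⟨_, hv', fun t ht htk i => ?_⟩
    have hcongr : ∀ r ∈ Icc (0 : ℝ) 1, r ≤ T →
        ∫ s in (0 : ℝ)..r, (d s i - (if s ≤ T then v s else EuclideanSpace.single j 1) i)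
          = ∫ s in (0 : ℝ)..r, (d s i - v s i) := by
      intro r hr hrT
      refine intervalIntegral.integral_congr fun s hs => ?_
      rw [uIcc_of_le hr.1] at hs
      simp [hs.2.trans hrT]
    rcases le_or_gt t T with htT | htT
    · rw [hcongr t ht htT]
      exact hvk t ht htT i
    have hint := (intervalIntegrable_apply_of_mem_bvInputs hd i).sub
      (intervalIntegrable_apply_of_mem_bvInputs hv' i)
    rw [← intervalIntegral.integral_add_adjacent_intervals (hint.mono_zero_one h0 hTI)
      (hint.mono_zero_one hTI ht), hcongr T hTI le_rfl]
    have hdI : ∀ s ∈ Icc T t, d s i ∈ Icc (0 : ℝ) 1 := fun s hs =>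
      (hd.1 s ⟨hT0.trans hs.1, hs.2.trans ht.2⟩).1 i
    have hlow : ∫ _ in T..t, (if i = j then (-1 : ℝ) else 0)
        ≤ ∫ s in T..t, (d s i - (if s ≤ T then v s else EuclideanSpace.single j 1) i) := by
      refine intervalIntegral.integral_mono_on_of_le_Ioo htT.le (by simp)
        (hint.mono_zero_one hTI ht) fun s hs => ?_
      have hsI := hdI s ⟨hs.1.le, hs.2.le⟩
      rw [if_neg hs.1.not_ge]
      by_cases hij : i = j
      · simp [hij] at hsI ⊢
        exact hsI.1
      · simpa [hij] using hsI.1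
    rw [intervalIntegral.integral_const] at hlow
    refine le_trans ?_ (add_le_add_right hlow _)
    by_cases hij : i = j
    · subst hij
      simp only [if_true, smul_eq_mul]
      push_cast at htk
      linarith
    · simpa [hij] using hvk T hTI le_rfl i

/-- Deficits that are all at least `-h` and sum to zero are at most `(q - 1) h`, so a slot length `ε
/ (q + 1)` suffices on both sides. -/
theorem exists_pure_abs_integral_sub_le {q : ℕ} {d : ℝ → EuclideanSpace ℝ (Fin q)}
    (hd : d ∈ bvInputs (relaxedSimplex q)) {ε : ℝ} (hε : 0 < ε) :
    ∃ v ∈ bvInputs (pureSimplex q), ∀ i, ∀ t ∈ Icc (0 : ℝ) 1,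
      |∫ s in (0 : ℝ)..t, (d s i - v s i)| ≤ ε := by
  have hq1 : (0 : ℝ) < q + 1 := by positivity
  set h := ε / (q + 1) with hh
  have hh0 : 0 < h := by positivity
  have hεh : ε = (q + 1) * h := by rw [hh]; field_simp
  obtain ⟨N, hN⟩ := exists_nat_ge (1 / h)
  obtain ⟨v, hv, hvN⟩ := exists_pure_neg_le_integral_sub hd hh0 N
  refine ⟨v, hv, fun i t ht => ?_⟩
  have htN : t ≤ N * h := ht.2.trans ((div_le_iff₀ hh0).1 hN)
  have hlow := hvN t ht htN
  have hsum := sum_integral_sub_eq_zero hd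
    (bvInputs_mono (pureSimplex_subset_relaxedSimplex q) hv) ht
  have hup : (∫ s in (0 : ℝ)..t, (d s i - v s i)) + h
      ≤ ∑ j, ((∫ s in (0 : ℝ)..t, (d s j - v s j)) + h) :=
    Finset.single_le_sum (f := fun j => (∫ s in (0 : ℝ)..t, (d s j - v s j)) + h)
      (fun j _ => by linarith [hlow j]) (Finset.mem_univ i)
  rw [Finset.sum_add_distrib, hsum] at hup
  simp only [Finset.sum_const, Finset.card_univ, Fintype.card_fin, nsmul_eq_mul, zero_add] at hup
  have hqh : 0 ≤ (q : ℝ) * h := by positivity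
  rw [abs_le, hεh]
  constructor
  · linarith [hlow i]
  · linarith

/-! ### Approximation of relaxed trajectories by pure ones -/

namespace SwitchedSystem

variable {n m q Nc : ℕ} {S : SwitchedSystem n m q Nc} {L : ℝ}

/-- Chattering: relaxed trajectories are uniform limits of pure ones. -/
theorem RegularDynamics.exists_pure_traj_near (hf : S.RegularDynamics L) (hL : 0 ≤ L)
    (hU : Bornology.IsBounded S.U) {ξ : SwitchedInput m q} (hξ : ξ ∈ S.Xr) {ε : ℝ} (hε : 0 < ε) :
    ∃ η ∈ S.Xp, ∀ t ∈ Icc (0 : ℝ) 1, ‖S.traj η t - S.traj ξ t‖ ≤ ε := by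
  have h0 : (0 : ℝ) ∈ Icc (0 : ℝ) 1 := ⟨le_rfl, zero_le_one⟩
  have hx := hf.isTrajectory_traj hL hU hξ
  set a := ε / (2 * Real.exp (2 * L)) with ha
  have ha0 : 0 < a := by positivity
  have haε : 2 * Real.exp (2 * L) * a = ε := by rw [ha]; field_simp
  obtain ⟨M, -, hM⟩ := hf.exists_bound_mode hL hU hx.continuousOn
  have hfi : ∀ i, IntervalIntegrable (fun s => S.f s (S.traj ξ s) (ξ.1 s) i) volume 0 1 :=
    fun i => intervalIntegrable_zero_one_of_bound
      (hf.aestronglyMeasurable_mode hL hξ hx.continuousOn i)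
      fun s hs => hM i s hs _ (hξ.1.1 s hs)
  -- The modes are evaluated along the relaxed trajectory, hence are fixed functions, and one `δ`
  -- can serve all of them before the pure input is chosen. Each mode gets the share `a / (q + 1)`.
  obtain ⟨δ, hδ, hδ0⟩ := ((eventually_all.2 fun i => (hfi i).eventually_norm_integral_smul_le
    (ε := a / (q + 1)) (by positivity)).and self_mem_nhdsWithin).exists
  obtain ⟨v, hv, hvd⟩ := exists_pure_abs_integral_sub_le hξ.2 hδ0
  have hvr := bvInputs_mono (pureSimplex_subset_relaxedSimplex q) hv
  have hη : (ξ.1, v) ∈ S.Xp := ⟨hξ.1, hv⟩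
  have hηr := S.Xp_subset_Xr hη
  refine ⟨(ξ.1, v), hη, fun t ht => ?_⟩
  rw [← haε]
  refine hf.norm_traj_sub_le hL hU hηr (hf.isTrajectory_traj hL hU hηr) hx ha0.le
    (fun t ht => ?_) t ht
  have e : ∀ s, S.field s (S.traj ξ s) (ξ.1 s) (v s) - S.field s (S.traj ξ s) (ξ.1 s) (ξ.2 s)
      = ∑ i, -((ξ.2 s i - v s i) • S.f s (S.traj ξ s) (ξ.1 s) i) := by
    intro s
    simp only [field, ← Finset.sum_sub_distrib]
    exact Finset.sum_congr rfl fun i _ => by module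
  have hwi : ∀ i, IntervalIntegrable (fun s => ξ.2 s i - v s i) volume 0 1 := fun i =>
    (intervalIntegrable_apply_of_mem_bvInputs hξ.2 i).sub
      (intervalIntegrable_apply_of_mem_bvInputs hv i)
  have hw1 : ∀ i, ∀ s ∈ Icc (0 : ℝ) 1, |ξ.2 s i - v s i| ≤ 1 := by
    intro i s hs
    have h1 := (hξ.2.1 s hs).1 i
    have h2 := (hvr.1 s hs).1 i
    rw [abs_le]
    constructor <;> linarith [h1.1, h1.2, h2.1, h2.2]
  have hwf : ∀ i, IntervalIntegrable
      (fun s => (ξ.2 s i - v s i) • S.f s (S.traj ξ s) (ξ.1 s) i) volume 0 1 := by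
    intro i
    refine intervalIntegrable_zero_one_of_bound (M := 1 * M)
      (((aestronglyMeasurable_apply hξ.2 i).sub (aestronglyMeasurable_apply hv i)).smul
        (hf.aestronglyMeasurable_mode hL hξ hx.continuousOn i)) fun s hs => ?_
    rw [norm_smul]
    exact mul_le_mul (hw1 i s hs) (hM i s hs _ (hξ.1.1 s hs)) (norm_nonneg _) zero_le_one
  simp only [e]
  rw [intervalIntegral.integral_finsetSum
    (f := fun i s => -((ξ.2 s i - v s i) • S.f s (S.traj ξ s) (ξ.1 s) i))
    fun i _ => ((hwf i).mono_zero_one h0 ht).neg]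
  refine (norm_sum_le_of_le _ (fun i _ => ?_) (n := fun _ => a / (q + 1))).trans ?_
  · rw [intervalIntegral.integral_neg, norm_neg]
    exact hδ i _ (hwi i) (hw1 i) (hvd i) t ht
  · have hq1 : (0 : ℝ) < q + 1 := by positivity
    simp only [Finset.sum_const, Finset.card_univ, Fintype.card_fin, nsmul_eq_mul]
    rw [mul_div_assoc', div_le_iff₀ hq1]
    linarith

end SwitchedSystem

/-! ### Directional derivatives from first-order expansions -/

theorem eventually_mul_lt_of_pos (k : ℝ) {c : ℝ} (hc : 0 < c) :
    ∀ᶠ l in 𝓝[>] (0 : ℝ), k * l < c := by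
  have h : Continuous fun l : ℝ => k * l := by fun_prop
  have h0 : Tendsto (fun l : ℝ => k * l) (𝓝 0) (𝓝 0) := by simpa using h.tendsto 0
  exact (h0.mono_left nhdsWithin_le_nhds).eventually (gt_mem_nhds hc)

theorem Continuous.isGreatest_iSup {α : Type*} [TopologicalSpace α] [CompactSpace α] [Nonempty α]
    {F : α → ℝ} (hF : Continuous F) : IsGreatest (range F) (⨆ p, F p) :=
  (isCompact_range hF).isGreatest_sSup (range_nonempty F)

theorem normL2_le_of_bound {k : ℕ} {v : ℝ → EuclideanSpace ℝ (Fin k)} {M : ℝ} (hM0 : 0 ≤ M)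
    (hM : ∀ t ∈ Icc (0 : ℝ) 1, ‖v t‖ ≤ M) : normL2 v ≤ M := by
  refine Real.sqrt_le_iff.2 ⟨hM0, (le_abs_self _).trans ?_⟩
  refine norm_integral_le_of_bound (g := fun s => ‖v s‖ ^ 2) (fun s hs => ?_) 1 ⟨zero_le_one, le_rfl⟩
  rw [norm_pow, norm_norm]
  exact pow_le_pow_left₀ (norm_nonneg _) (hM s hs) 2

theorem normL2_nonneg {k : ℕ} (v : ℝ → EuclideanSpace ℝ (Fin k)) : 0 ≤ normL2 v :=
  Real.sqrt_nonneg _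

theorem normX_nonneg {m q : ℕ} (ξ : SwitchedInput m q) : 0 ≤ normX ξ :=
  add_nonneg (normL2_nonneg _) (normL2_nonneg _)

theorem normX_zero {m q : ℕ} : normX (0 : SwitchedInput m q) = 0 := by
  simp [normX, normL2]

theorem tendsto_diffQuotient_of_expansion {m q : ℕ} {G : SwitchedInput m q → ℝ}
    {ξ ζ : SwitchedInput m q} {a D : ℝ}
    (h : ∀ l ∈ Icc (0 : ℝ) 1, |G (ξ + l • ζ) - G ξ - l * a| ≤ D * l ^ 2) :
    Tendsto (diffQuotient G ξ ζ) (𝓝[>] 0) (𝓝 a) := by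
  rw [tendsto_iff_norm_sub_tendsto_zero]
  have hD : Tendsto (fun l : ℝ => D * l) (𝓝[>] 0) (𝓝 0) := by
    have hc : Continuous fun l : ℝ => D * l := by fun_prop
    have h0 : Tendsto (fun l : ℝ => D * l) (𝓝 0) (𝓝 0) := by simpa using hc.tendsto 0
    exact h0.mono_left nhdsWithin_le_nhds
  refine squeeze_zero' (Eventually.of_forall fun _ => norm_nonneg _) ?_ hD
  filter_upwards [Ioc_mem_nhdsGT (zero_lt_one (α := ℝ))] with l hl
  have e : diffQuotient G ξ ζ l - a = (G (ξ + l • ζ) - G ξ - l * a) / l := by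
    have := hl.1.ne'
    rw [diffQuotient]
    field_simp
  rw [e, norm_div, Real.norm_eq_abs, Real.norm_of_nonneg hl.1.le, div_le_iff₀ hl.1]
  refine (h l ⟨hl.1.le, hl.2⟩).trans (le_of_eq (by ring))

theorem dirDeriv_eq_of_tendsto {m q : ℕ} {G : SwitchedInput m q → ℝ}
    {ξ ζ : SwitchedInput m q} {a : ℝ} (h : Tendsto (diffQuotient G ξ ζ) (𝓝[>] 0) (𝓝 a)) :
    dirDeriv G ξ ζ = a :=
  h.limUnder_eq

theorem dirDeriv_zero_right {m q : ℕ} (G : SwitchedInput m q → ℝ) (ξ : SwitchedInput m q) :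
    dirDeriv G ξ 0 = 0 :=
  dirDeriv_eq_of_tendsto (tendsto_diffQuotient_of_expansion (D := 0) fun l _ => by simp)

/-- First-order expansion of a cost function along an expansion of its argument. -/
theorem abs_sub_fderiv_le_of_expansion {V : Type*} [NormedAddCommGroup V] [NormedSpace ℝ V]
    {g : V → ℝ} {L C l : ℝ} (hL : 0 ≤ L) (hd : Differentiable ℝ g)
    (hlip : ∀ x y, |g x - g y| ≤ L * ‖x - y‖)
    (hdlip : ∀ x y, ‖fderiv ℝ g x - fderiv ℝ g y‖ ≤ L * ‖x - y‖) {x y z : V}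
    (h1 : ‖y - x‖ ≤ C * l) (h2 : ‖y - x - l • z‖ ≤ C * l ^ 2) :
    |g y - g x - l * fderiv ℝ g x z| ≤ (L * C ^ 2 + L * C) * l ^ 2 := by
  have h3 := convex_univ.norm_taylor_sub_le hL (fun x _ => hd x) (fun x _ y _ => hdlip x y)
    (mem_univ x) (mem_univ y)
  have h4 : ‖fderiv ℝ g x (y - x - l • z)‖ ≤ L * (C * l ^ 2) :=
    ContinuousLinearMap.le_of_opNorm_le_of_le _
      (norm_fderiv_le_of_lip' ℝ hL (Eventually.of_forall fun y => hlip y x)) h2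
  have e : g y - g x - l * fderiv ℝ g x z
      = (g y - g x - fderiv ℝ g x (y - x)) + fderiv ℝ g x (y - x - l • z) := by
    simp only [map_sub, map_smul, smul_eq_mul]
    ring
  rw [e]
  calc _ ≤ _ := abs_add_le _ _
    _ ≤ L * ‖y - x‖ * ‖y - x‖ + L * (C * l ^ 2) := add_le_add h3 h4
    _ ≤ L * (C * l) * (C * l) + L * (C * l ^ 2) := by
        have := (norm_nonneg _).trans h1
        gcongr
    _ = _ := by ring

/-! ### The optimality function and local minimizers -/

namespace SwitchedSystem

variable {n m q Nc : ℕ} {S : SwitchedSystem n m q Nc} {L : ℝ}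

theorem RegularCost.continuous_psi (hh : S.RegularCost L) {ξ : SwitchedInput m q}
    (hx : ContinuousOn (S.traj ξ) (Icc 0 1)) : Continuous fun p => S.psi p ξ :=
  continuous_prod_of_discrete_left.2 fun j =>
    (hh.diff_h j).continuous.comp (continuousOn_iff_continuous_domRestrict.1 hx)

/-- First-order expansions of the cost and of the constraints along a convex perturbation. -/
theorem exists_dirDeriv_expansion (hf : S.RegularDynamics L) (hh : S.RegularCost L) (hL : 0 ≤ L)
    (hUb : Bornology.IsBounded S.U) (hUc : Convex ℝ S.U) {ξ : SwitchedInput m q} (hξ : ξ ∈ S.Xr) :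
    ∃ B, ∀ ξ' ∈ S.Xr, |dirDeriv S.J ξ (ξ' - ξ)| ≤ B ∧
      Tendsto (diffQuotient S.J ξ (ξ' - ξ)) (𝓝[>] 0) (𝓝 (dirDeriv S.J ξ (ξ' - ξ))) ∧
      (∀ p, Tendsto (diffQuotient (S.psi p) ξ (ξ' - ξ)) (𝓝[>] 0)
        (𝓝 (dirDeriv (S.psi p) ξ (ξ' - ξ)))) ∧
      Continuous (fun p => dirDeriv (S.psi p) ξ (ξ' - ξ)) ∧
      ∃ D, 0 ≤ D ∧ ∀ l ∈ Icc (0 : ℝ) 1,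
        (∀ t ∈ Icc (0 : ℝ) 1, ‖S.traj (ξ + l • (ξ' - ξ)) t - S.traj ξ t‖ ≤ D * l) ∧
        |S.J (ξ + l • (ξ' - ξ)) - S.J ξ - l * dirDeriv S.J ξ (ξ' - ξ)| ≤ D * l ^ 2 ∧
        ∀ p, |S.psi p (ξ + l • (ξ' - ξ)) - S.psi p ξ - l * dirDeriv (S.psi p) ξ (ξ' - ξ)|
          ≤ D * l ^ 2 := by
  obtain ⟨B, hB0, hB⟩ := hf.exists_traj_expansion hL hUb hUc hξ
  have h1 : (1 : ℝ) ∈ Icc (0 : ℝ) 1 := ⟨zero_le_one, le_rfl⟩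
  refine ⟨L * B, fun ξ' hξ' => ?_⟩
  obtain ⟨z, hzc, hzB, C, hC0, hC⟩ := hB ξ' hξ'
  have eJ : ∀ l ∈ Icc (0 : ℝ) 1, |S.J (ξ + l • (ξ' - ξ)) - S.J ξ
      - l * fderiv ℝ S.h₀ (S.traj ξ 1) (z 1)| ≤ (L * C ^ 2 + L * C) * l ^ 2 := fun l hl =>
    abs_sub_fderiv_le_of_expansion hL hh.diff_h₀ hh.lip_h₀ hh.lip_dh₀ (hC l hl 1 h1).1
      (hC l hl 1 h1).2
  have ep : ∀ p, ∀ l ∈ Icc (0 : ℝ) 1, |S.psi p (ξ + l • (ξ' - ξ)) - S.psi p ξ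
      - l * fderiv ℝ (S.h p.1) (S.traj ξ p.2) (z p.2)| ≤ (L * C ^ 2 + L * C) * l ^ 2 :=
    fun p l hl => abs_sub_fderiv_le_of_expansion hL (hh.diff_h p.1) (hh.lip_h p.1) (hh.lip_dh p.1)
      (hC l hl p.2 p.2.2).1 (hC l hl p.2 p.2.2).2
  have tJ := tendsto_diffQuotient_of_expansion eJ
  have tp := fun p => tendsto_diffQuotient_of_expansion (ep p)
  have dJ := dirDeriv_eq_of_tendsto tJ
  have dp := fun p => dirDeriv_eq_of_tendsto (tp p)
  simp only [dJ, dp]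
  refine ⟨?_, tJ, tp, ?_, C + (L * C ^ 2 + L * C), by positivity, fun l hl => ⟨fun t ht => ?_,
    ?_, fun p => ?_⟩⟩
  · exact ContinuousLinearMap.le_of_opNorm_le_of_le _
      (norm_fderiv_le_of_lip' ℝ hL (f := S.h₀)
        (Eventually.of_forall fun y => hh.lip_h₀ y (S.traj ξ 1))) (hzB 1 h1)
  · refine continuous_prod_of_discrete_left.2 fun j => ?_
    have hd : Continuous (fderiv ℝ (S.h j)) :=
      (LipschitzWith.of_dist_le_mul (K := L.toNNReal) fun x y => by
        rw [dist_eq_norm, dist_eq_norm, Real.coe_toNNReal _ hL]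
        exact hh.lip_dh j x y).continuous
    exact (hd.comp (continuousOn_iff_continuous_domRestrict.1
      (hf.continuousOn_traj hL hUb hξ))).clm_apply (hzc.comp continuous_subtype_val)
  · exact ((hC l hl t ht).1).trans
      (mul_le_mul_of_nonneg_right (le_add_of_nonneg_right (by positivity)) hl.1)
  · exact (eJ l hl).trans
      (mul_le_mul_of_nonneg_right (le_add_of_nonneg_left hC0) (by positivity))
  · exact (ep p l hl).trans
      (mul_le_mul_of_nonneg_right (le_add_of_nonneg_left hC0) (by positivity))

/-- All derivatives in direction zero vanish, and in each branch the leftover term, `γΨ` or `-Ψ`, is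
nonpositive. -/
theorem zeta_self (S : SwitchedSystem n m q Nc) {γ : ℝ} (hγ : 0 ≤ γ) (ξ : SwitchedInput m q) :
    S.zeta γ ξ ξ = 0 := by
  have h : S.maxDpsi ξ 0 = 0 := by simp [maxDpsi, dirDeriv_zero_right]
  simp only [zeta, sub_self, dirDeriv_zero_right, normX_zero, h]
  split_ifs with hΨ
  · simpa using mul_nonpos_of_nonneg_of_nonpos hγ hΨ
  · simpa using (not_le.1 hΨ).le

/-- The cost entry of the maximum alone bounds `ζ(ξ, ·)` from below, its derivative being bounded
uniformly in `ξ'`; the value at `ξ' = ξ` gives the sign. -/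
theorem theta_spec (hf : S.RegularDynamics L) (hh : S.RegularCost L) (hL : 0 ≤ L)
    (hUb : Bornology.IsBounded S.U) (hUc : Convex ℝ S.U) {γ : ℝ} (hγ : 0 ≤ γ)
    {ξ : SwitchedInput m q} (hξ : ξ ∈ S.Xr) :
    IsGLB (S.zeta γ ξ '' S.Xr) (S.theta γ ξ) ∧ S.theta γ ξ ≤ 0 := by
  obtain ⟨B, hB⟩ := exists_dirDeriv_expansion hf hh hL hUb hUc hξ
  have hbdd : BddBelow (S.zeta γ ξ '' S.Xr) := by
    refine ⟨-B - |S.Psi ξ|, ?_⟩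
    rintro _ ⟨ξ', hξ', rfl⟩
    have h1 := (abs_le.1 (hB ξ' hξ').1).1
    have h2 := normX_nonneg (ξ' - ξ)
    have h3 := abs_nonneg (S.Psi ξ)
    have h4 := le_abs_self (S.Psi ξ)
    rw [zeta]
    split_ifs
    · have := le_max_left (dirDeriv S.J ξ (ξ' - ξ)) (S.maxDpsi ξ (ξ' - ξ) + γ * S.Psi ξ)
      linarith
    · have := le_max_left (dirDeriv S.J ξ (ξ' - ξ) - S.Psi ξ) (S.maxDpsi ξ (ξ' - ξ))
      linarith
  have hmem : 0 ∈ S.zeta γ ξ '' S.Xr := ⟨ξ, hξ, S.zeta_self hγ ξ⟩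
  exact ⟨isGLB_csInf ⟨0, hmem⟩ hbdd, csInf_le hbdd hmem⟩

theorem IsLocalMinimizer.theta_eq_zero (hNc : 1 ≤ Nc) (hf : S.RegularDynamics L)
    (hh : S.RegularCost L) (hL : 0 < L) (hUb : Bornology.IsBounded S.U) (hUc : Convex ℝ S.U)
    {γ : ℝ} (hγ : 0 ≤ γ) {ξ : SwitchedInput m q} (hmin : S.IsLocalMinimizer ξ) :
    S.theta γ ξ = 0 := by
  obtain ⟨hξp, hΨ, ε, hε, hmin⟩ := hmin
  have : Nonempty (Fin Nc) := ⟨⟨0, hNc⟩⟩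
  have hξ := S.Xp_subset_Xr hξp
  refine le_antisymm (theta_spec hf hh hL.le hUb hUc hγ hξ).2 (not_lt.1 fun hlt => ?_)
  obtain ⟨_, ⟨ξ', hξ', rfl⟩, hneg⟩ := exists_lt_of_csInf_lt (Set.Nonempty.image _ ⟨ξ, hξ⟩) hlt
  obtain ⟨B, hB⟩ := exists_dirDeriv_expansion hf hh hL.le hUb hUc hξ
  obtain ⟨-, -, -, hcont, D, hD0, hD⟩ := hB ξ' hξ'
  have hgr : ∀ p, dirDeriv (S.psi p) ξ (ξ' - ξ) ≤ S.maxDpsi ξ (ξ' - ξ) := fun p =>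
    hcont.isGreatest_iSup.2 (mem_range_self p)
  have hψ : ∀ p, S.psi p ξ ≤ S.Psi ξ := fun p =>
    (hh.continuous_psi (hf.continuousOn_traj hL.le hUb hξ)).isGreatest_iSup.2 (mem_range_self p)
  rw [zeta, if_pos hΨ] at hneg
  have hmax : max (dirDeriv S.J ξ (ξ' - ξ)) (S.maxDpsi ξ (ξ' - ξ) + γ * S.Psi ξ) < 0 := by
    linarith [normX_nonneg (ξ' - ξ)]
  obtain ⟨c, hc, hcJ, hcψ⟩ : ∃ c > 0, dirDeriv S.J ξ (ξ' - ξ) ≤ -c ∧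
      S.maxDpsi ξ (ξ' - ξ) + γ * S.Psi ξ ≤ -c :=
    ⟨_, neg_pos.2 hmax, by rw [neg_neg]; exact le_max_left _ _,
      by rw [neg_neg]; exact le_max_right _ _⟩
  -- `γl < 1` keeps `(1 - γl)Ψ(ξ)` nonpositive, `Dl < c/2` lets the quadratic error eat at most half
  -- of the gain `cl`, and `Dl < ε/2` keeps the relaxed trajectory within half the radius.
  obtain ⟨l, ⟨⟨⟨hl0, hl1⟩, hlγ⟩, hlc⟩, hlε⟩ := (((Filter.Eventually.and
    (p := fun l : ℝ => l ∈ Ioc (0 : ℝ) 1) (Ioc_mem_nhdsGT zero_lt_one)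
    (eventually_mul_lt_of_pos γ zero_lt_one)).and (eventually_mul_lt_of_pos D (half_pos hc))).and
    (eventually_mul_lt_of_pos D (half_pos hε))).exists
  obtain ⟨hDx, hDJ, hDψ⟩ := hD l ⟨hl0.le, hl1⟩
  have hξl : ξ + l • (ξ' - ξ) ∈ S.Xr := (convex_Xr hUc).add_smul_sub_mem hξ hξ' ⟨hl0.le, hl1⟩
  have hDl : D * l ^ 2 ≤ c / 2 * l := by
    rw [pow_two, ← mul_assoc]
    exact mul_le_mul_of_nonneg_right hlc.le hl0.le
  -- Rounding then moves each cost by at most `cl/4`, leaving a gain of `cl/4`, and brings the total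
  -- distance to at most `3ε/4`.
  have hρ : 0 < min (c * l / (4 * L)) (ε / 4) := lt_min (by positivity) (by positivity)
  obtain ⟨η, hη, hηx⟩ := hf.exists_pure_traj_near hL.le hUb hξl hρ
  have hηL : ∀ t ∈ Icc (0 : ℝ) 1,
      L * ‖S.traj η t - S.traj (ξ + l • (ξ' - ξ)) t‖ ≤ c * l / 4 := by
    intro t ht
    calc _ ≤ L * (c * l / (4 * L)) :=
          mul_le_mul_of_nonneg_left ((hηx t ht).trans (min_le_left _ _)) hL.le
      _ = _ := by field_simp
  have hJη : S.J η < S.J ξ := by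
    have h1 := (abs_le.1 ((hh.lip_h₀ (S.traj η 1) (S.traj (ξ + l • (ξ' - ξ)) 1)).trans
      (hηL 1 ⟨zero_le_one, le_rfl⟩))).2
    have h2 := (abs_le.1 hDJ).2
    have h3 := mul_le_mul_of_nonneg_left hcJ hl0.le
    have h4 : 0 < c * l := by positivity
    rw [J, J] at *
    linarith
  -- Each constraint at `η` is at most `Ψ(ξ) + l(-c - γΨ(ξ)) + cl/2 + cl/4 = (1 - γl)Ψ(ξ) - cl/4`.
  have hΨη : S.Psi η ≤ 0 := by
    refine ciSup_le fun p => ?_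
    have h1 := (abs_le.1 ((hh.lip_h p.1 (S.traj η p.2) (S.traj (ξ + l • (ξ' - ξ)) p.2)).trans
      (hηL p.2 p.2.2))).2
    have h2 := (abs_le.1 (hDψ p)).2
    have h3 := mul_le_mul_of_nonneg_left ((hgr p).trans (le_sub_iff_add_le.2 hcψ)) hl0.le
    have h4 : 0 < c * l := by positivity
    have h5 := mul_nonpos_of_nonneg_of_nonpos (sub_nonneg.2 hlγ.le) hΨ
    have h6 := hψ p
    simp only [psi] at *
    linarith
  refine absurd (hmin η ⟨⟨S.Xp_subset_Xr hη, ?_⟩, hη, hΨη⟩) (not_le.2 hJη)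
  refine (normL2_le_of_bound (M := 3 / 4 * ε) (by positivity) fun t ht => ?_).trans_lt
    (by linarith)
  rw [Pi.sub_apply, norm_sub_rev]
  have h1 := norm_sub_le_norm_sub_add_norm_sub (S.traj η t) (S.traj (ξ + l • (ξ' - ξ)) t)
    (S.traj ξ t)
  have h2 := (hηx t ht).trans (min_le_right _ _)
  linarith [hDx t ht]

end SwitchedSystem

theorem mainTheorem2 {n m q Nc : ℕ} (hNc : 1 ≤ Nc) (S : SwitchedSystem n m q Nc)
    (hU_bdd : Bornology.IsBounded S.U) (hU_conv : Convex ℝ S.U)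
    (L : ℝ) (hL : 0 < L) (hf : S.RegularDynamics L) (hh : S.RegularCost L)
    (γ : ℝ) (hγ : 0 < γ) :
    -- the objects that enter the optimality function are well defined:
    -- trajectories exist and are unique on `[0,1]`, and the maximum `Ψ` is attained;
    (∀ ξ ∈ S.Xr, S.IsTrajectory ξ (S.traj ξ) ∧
      (∀ y, S.IsTrajectory ξ y → Set.EqOn y (S.traj ξ) (Set.Icc 0 1)) ∧
      IsGreatest (Set.range fun p => S.psi p ξ) (S.Psi ξ)) ∧
    -- directional derivatives exist and their maximum is attained;
    (∀ ξ ∈ S.Xp, ∀ ξ' ∈ S.Xr,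
      Filter.Tendsto (diffQuotient S.J ξ (ξ' - ξ)) (nhdsWithin 0 (Set.Ioi 0))
        (nhds (dirDeriv S.J ξ (ξ' - ξ))) ∧
      (∀ p, Filter.Tendsto (diffQuotient (S.psi p) ξ (ξ' - ξ)) (nhdsWithin 0 (Set.Ioi 0))
        (nhds (dirDeriv (S.psi p) ξ (ξ' - ξ)))) ∧
      IsGreatest (Set.range fun p => dirDeriv (S.psi p) ξ (ξ' - ξ)) (S.maxDpsi ξ (ξ' - ξ))) ∧
    -- `θ(ξ)` is the (finite) infimum of `ζ(ξ, ·)` over `𝒳_r`, and it is non-positive;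
    (∀ ξ ∈ S.Xp, IsGLB (S.zeta γ ξ '' S.Xr) (S.theta γ ξ) ∧ S.theta γ ξ ≤ 0) ∧
    -- local minimizers are zeros of `θ`.
    (∀ ξ, S.IsLocalMinimizer ξ → S.theta γ ξ = 0) := by
  have hL0 := hL.le
  have : Nonempty (Fin Nc) := ⟨⟨0, hNc⟩⟩
  refine ⟨fun ξ hξ => ⟨hf.isTrajectory_traj hL0 hU_bdd hξ,
    fun y hy => hf.eqOn_traj hL0 hU_bdd hξ hy,
    (hh.continuous_psi (hf.continuousOn_traj hL0 hU_bdd hξ)).isGreatest_iSup⟩,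
    fun ξ hξ ξ' hξ' => ?_,
    fun ξ hξ => SwitchedSystem.theta_spec hf hh hL0 hU_bdd hU_conv hγ.le (S.Xp_subset_Xr hξ),
    fun ξ hξ => hξ.theta_eq_zero hNc hf hh hL hU_bdd hU_conv hγ.le⟩
  obtain ⟨B, hB⟩ := SwitchedSystem.exists_dirDeriv_expansion hf hh hL0 hU_bdd hU_conv
    (S.Xp_subset_Xr hξ)
  obtain ⟨-, hJ, hψ, hcont, -⟩ := hB ξ' hξ'
  exact ⟨hJ, hψ, hcont.isGreatest_iSup⟩
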